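/- Let $p$ be a prime and let $(S,\mathcal F,\mathcal L)$ be a $p$-local compact group: $S$ is a discrete $p$-toral group, $\mathcal F$ is a saturated fusion system over $S$, and $\mathcal L$ is a centric linking system associated to $\mathcal F$, with projection functor $\pi\colon\mathcal L\to\mathcal F$. Let $P\le S$ be fully normalized in $\mathcal F$ and $\mathcal F$-centric, but not $\mathcal F$-radical. The normalizer $N_{\mathcal F}P$ has as objects the subgroups of $N_SP$; its morphisms $Q\to R$ are those $\varphi\in\mathrm{Hom}_{\mathcal F}(Q,R)$ that extend to some $\varphi'\in\mathrm{Hom}_{\mathcal F}(QP,RP)$ with $\varphi'(P)=P$. The category $N_{\mathcal L}P$ has as objects the $N_{\mathcal F}P$-centric subgroups of $N_SP$; its morphisms $Q\to R$ are those $\varphi\in\mathrm{Hom}_{\mathcal L}(QP,RP)$ with $\pi(\varphi)|_Q\in\mathrm{Hom}_{N_{\mathcal F}P}(Q,R)$ and $\pi(\varphi)(P)=P$. Let $P\downarrow_{\not\cong}N_{\mathcal L}P$ be the full subcategory of the undercategory $P\downarrow N_{\mathcal L}P$ on the morphisms $P\to Q$ that are not isomorphisms in $\mathcal L$. For $\alpha\in\mathrm{Aut}_{\mathcal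 F}(P)$ put $N_\alpha=\{y\in N_SP : \alpha c_y\alpha^{-1}\in\mathrm{Aut}_S(P)\}$, where $c_y$ is conjugation by $y$, and let $\widetilde P=\bigcap_{\alpha\in\mathrm{Aut}_{\mathcal F}(P)}N_\alpha$. Then: 1. $\widetilde P$ is the largest subgroup $Q$ with $P\le Q\le N_SP$ such that every $\alpha\in\mathrm{Aut}_{\mathcal F}(P)$ extends to a morphism $Q\to S$ of $\mathcal F$; 2. $\widetilde P$ properly contains $P$; 3. the geometric realizations of the nerves are homotopy equivalent, $|P\downarrow_{\not\cong}N_{\mathcal L}P|\simeq|\widetilde P\downarrow N_{\mathcal L}P|$; 4. the undercategory $\widetilde P\downarrow N_{\mathcal L}P$ has an initial object, and the realizations of both nerves are contractible. -/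

import Mathlib

open CategoryTheory

universe v u

/-! ### Discrete `p`-toral groups -/

/-- The Prüfer group `ℤ/p^∞`, as the group of complex roots of unity of `p`-power order. -/
abbrev PruferGroup (p : ℕ) : Type := CommGroup.primaryComponent ℂˣ p

/-- `G` is an extension of a finite `p`-group of order `s.2` by `(ℤ/p^∞)^(s.1)`. -/
def HasSize (p : ℕ) (G : Type u) [Group G] (s : ℕ × ℕ) : Prop :=
  ∃ (N : Subgroup G) (_ : N.Normal), Nonempty (N ≃* (Fin s.1 → PruferGroup p)) ∧
    Finite (G ⧸ N) ∧ IsPGroup p (G ⧸ N) ∧ Nat.card (G ⧸ N) = s.2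

/-- Discrete `p`-toral groups. -/
def IsDiscretePToral (p : ℕ) (G : Type u) [Group G] : Prop :=
  ∃ s : ℕ × ℕ, HasSize p G s

open Classical in
/-- The size `(rank, number of components)` of a discrete `p`-toral group, in the lexicographic
order. (It is unique, see `HasSize.unique`; the value for other groups is irrelevant.) -/
noncomputable def pSize (p : ℕ) (G : Type u) [Group G] : ℕ ×ₗ ℕ :=
  if h : ∃ s : ℕ × ℕ, HasSize p G s then toLex h.choose else toLex (0, 0)

theorem PruferGroup.exists_pow_eq (p : ℕ) [Fact p.Prime] (n : ℕ) (x : PruferGroup p) :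
    ∃ y : PruferGroup p, y ^ p ^ n = x := by
  have hp : p ≠ 0 := (Fact.out : p.Prime).ne_zero
  have hpn : p ^ n ≠ 0 := pow_ne_zero _ hp
  obtain ⟨z, hz⟩ := IsAlgClosed.exists_pow_nat_eq ((x : ℂˣ) : ℂ) (Nat.pos_of_ne_zero hpn)
  have hz0 : z ≠ 0 := by
    rintro rfl
    rw [zero_pow hpn] at hz
    exact (x : ℂˣ).ne_zero hz.symm
  have hu : (Units.mk0 z hz0) ^ p ^ n = (x : ℂˣ) := by
    ext
    simpa using hz
  obtain ⟨k, hk⟩ := x.2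
  refine ⟨⟨Units.mk0 z hz0, n + k, ?_⟩, ?_⟩
  · rw [pow_add, pow_mul, hu, hk]
  · ext1
    exact hu

theorem PruferGroup.card_torsion (p : ℕ) [Fact p.Prime] :
    Nat.card {x : PruferGroup p // x ^ p = 1} = p := by
  have hp : NeZero p := ⟨(Fact.out : p.Prime).ne_zero⟩
  have e : {x : PruferGroup p // x ^ p = 1} ≃ rootsOfUnity p ℂ :=
    { toFun := fun x => ⟨x.1.1, by
        have := congrArg Subtype.val x.2
        simpa [mem_rootsOfUnity] using this⟩
      invFun := fun x => ⟨⟨x.1, 1, by simpa using (mem_rootsOfUnity p x.1).1 x.2⟩, by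
        ext1
        exact (mem_rootsOfUnity p x.1).1 x.2⟩
      left_inv := fun _ => rfl
      right_inv := fun _ => rfl }
  rw [Nat.card_congr e]
  exact Complex.card_rootsOfUnity p

/-- The size of a discrete `p`-toral group is well defined. -/
theorem HasSize.unique {p : ℕ} [Fact p.Prime] {G : Type u} [Group G] {s t : ℕ × ℕ}
    (hs : HasSize p G s) (ht : HasSize p G t) : s = t := by
  have key : ∀ {s t : ℕ × ℕ} (N M : Subgroup G) [N.Normal] [M.Normal],
      Nonempty (N ≃* (Fin s.1 → PruferGroup p)) → Finite (G ⧸ M) → IsPGroup p (G ⧸ M) →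
      N ≤ M := by
    intro s t N M _ _ ⟨e⟩ hM hpM x hx
    obtain ⟨n, hn⟩ := IsPGroup.iff_card.1 hpM
    choose y hy using fun i => PruferGroup.exists_pow_eq p n (e ⟨x, hx⟩ i)
    have h1 : (e.symm y) ^ p ^ n = ⟨x, hx⟩ := by
      rw [← map_pow, MulEquiv.symm_apply_eq]
      funext i
      exact hy i
    have h2 : ((e.symm y : N) : G) ^ p ^ n = x := congrArg Subtype.val h1
    rw [← QuotientGroup.eq_one_iff, ← h2, QuotientGroup.mk_pow, ← hn]
    exact pow_card_eq_one'
  obtain ⟨N, hN, ⟨e⟩, hNf, hNp, hNc⟩ := hs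
  obtain ⟨M, hM, ⟨f⟩, hMf, hMp, hMc⟩ := ht
  obtain rfl : N = M := le_antisymm (key (s := s) (t := t) N M ⟨e⟩ hMf hMp)
    (key (s := t) (t := s) M N ⟨f⟩ hNf hNp)
  have hcard : ∀ k, Nat.card {x : Fin k → PruferGroup p // x ^ p = 1} = p ^ k := by
    intro k
    have e' : {x : Fin k → PruferGroup p // x ^ p = 1} ≃
        (Fin k → {x : PruferGroup p // x ^ p = 1}) :=
      { toFun := fun x i => ⟨x.1 i, congrFun x.2 i⟩
        invFun := fun x => ⟨fun i => (x i).1, funext fun i => (x i).2⟩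
        left_inv := fun _ => rfl
        right_inv := fun _ => rfl }
    rw [Nat.card_congr e', Nat.card_pi]
    simp [PruferGroup.card_torsion]
  let g := e.symm.trans f
  have hg : Nat.card {x : Fin s.1 → PruferGroup p // x ^ p = 1} =
      Nat.card {x : Fin t.1 → PruferGroup p // x ^ p = 1} := by
    refine Nat.card_congr (g.toEquiv.subtypeEquiv fun x => ?_)
    have : g.toEquiv x ^ p = 1 ↔ x ^ p = 1 := by
      change g x ^ p = 1 ↔ _
      rw [← map_pow, map_eq_one_iff g g.injective]
    exact this.symm
  rw [hcard, hcard] at hg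
  exact Prod.ext (Nat.pow_right_injective (Fact.out : p.Prime).two_le hg) (hNc.symm.trans hMc)

/-! ### Fusion systems -/

section Subgroups

variable {S : Type u} [Group S]

/-- The homomorphism `c_g : P → Q`, `x ↦ g x g⁻¹`, for `g ∈ S` with `g P g⁻¹ ≤ Q`. -/
def conjHom {P Q : Subgroup S} (g : S) (h : ∀ x ∈ P, g * x * g⁻¹ ∈ Q) : P →* Q :=
  ((MulAut.conj g).toMonoidHom.comp P.subtype).codRestrict Q fun x => h x x.2

/-- The image of `φ : P → Q`, as a subgroup of the ambient group `S`. -/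
def homImage {P Q : Subgroup S} (φ : P →* Q) : Subgroup S := φ.range.map Q.subtype

/-- The restriction of `φ : Q → R` to a subgroup `P ≤ Q`. -/
def homRestrict {P Q R : Subgroup S} (φ : Q →* R) (h : P ≤ Q) : P →* R :=
  φ.comp (Subgroup.inclusion h)

/-- `Aut_S(P)`: the automorphisms of `P` induced by conjugation by elements of `N_S(P)`. -/
def autS (P : Subgroup S) : Subgroup (MulAut P) := P.normalizerMonoidHom.range

/-- `Aut_P(P)`: the inner automorphisms of `P`. -/
def innerAut (P : Subgroup S) : Subgroup (MulAut P) := (MulAut.conj : P →* MulAut P).range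

instance innerAut_normal (P : Subgroup S) : (innerAut P).Normal := by
  refine ⟨?_⟩
  rintro _ ⟨x, rfl⟩ α
  refine ⟨α x, ?_⟩
  ext y
  simp [MulAut.conj_apply]

/-- For `φ : P → Q`, the group `N_φ` of those `g ∈ N_S(P)` with `φ c_g φ⁻¹ ∈ Aut_S(φ(P))`, i.e.
such that `φ ∘ c_g = c ∘ φ` for some `c ∈ Aut_S(φ(P))`. -/
def homExtensionGroup {P Q : Subgroup S} (φ : P →* Q) : Subgroup S :=
  Subgroup.map (Subgroup.normalizer (P : Set S)).subtype
    { carrier := {g | ∃ c ∈ autS (homImage φ), ∀ x : P,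
        ((φ (P.normalizerMonoidHom g x) : Q) : S) =
          c ⟨φ x, Subgroup.mem_map_of_mem Q.subtype ⟨x, rfl⟩⟩}
      one_mem' := ⟨1, one_mem _, fun x => by simp⟩
      mul_mem' := by
        rintro a b ⟨c, hc, hac⟩ ⟨d, hd, hbd⟩
        refine ⟨c * d, mul_mem hc hd, fun x => ?_⟩
        rw [map_mul, MulAut.mul_apply, hac, MulAut.mul_apply]
        congr 2
        exact Subtype.ext (hbd x)
      inv_mem' := by
        rintro a ⟨c, hc, hac⟩
        refine ⟨c⁻¹, inv_mem hc, fun x => ?_⟩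
        have h := hac (P.normalizerMonoidHom a⁻¹ x)
        rw [← MulAut.mul_apply, ← map_mul, mul_inv_cancel, map_one, MulAut.one_apply] at h
        have h2 : (⟨φ x, Subgroup.mem_map_of_mem Q.subtype ⟨x, rfl⟩⟩ : homImage φ) =
            c ⟨φ (P.normalizerMonoidHom a⁻¹ x),
              Subgroup.mem_map_of_mem Q.subtype ⟨_, rfl⟩⟩ := Subtype.ext h
        rw [h2, MulAut.inv_apply_self] }

/-- For `α ∈ Aut(P)`, the group `N_α` of those `y ∈ N_S(P)` with `α c_y α⁻¹ ∈ Aut_S(P)`. -/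
def autExtensionGroup (P : Subgroup S) (α : MulAut P) : Subgroup S :=
  Subgroup.map (Subgroup.normalizer (P : Set S)).subtype
    ((autS P).comap ((MulAut.conj α).toMonoidHom.comp P.normalizerMonoidHom))

theorem mem_autExtensionGroup {P : Subgroup S} {α : MulAut P} {y : S} :
    y ∈ autExtensionGroup P α ↔ ∃ hy : y ∈ Subgroup.normalizer (P : Set S),
      α * P.normalizerMonoidHom ⟨y, hy⟩ * α⁻¹ ∈ autS P := by
  simp [autExtensionGroup, Subgroup.mem_map, MulAut.conj_apply]

end Subgroups

/-- A fusion system over `S`: a category whose objects are the subgroups of `S` and whose morphisms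
are injective group homomorphisms, containing all the homomorphisms `c_g` with `g ∈ S` (in
particular all identities and inclusions), and such that each morphism is an isomorphism of the
category followed by an inclusion. -/
structure FusionSystem (S : Type u) [Group S] where
  /-- The morphisms `P → Q`. -/
  Hom : (P Q : Subgroup S) → Set (P →* Q)
  injective : ∀ {P Q : Subgroup S} {φ : P →* Q}, φ ∈ Hom P Q → Function.Injective φ
  comp_mem : ∀ {P Q R : Subgroup S} {φ : P →* Q} {ψ : Q →* R},
    φ ∈ Hom P Q → ψ ∈ Hom Q R → ψ.comp φ ∈ Hom P R
  conj_mem : ∀ {P Q : Subgroup S} (g : S) (h : ∀ x ∈ P, g * x * g⁻¹ ∈ Q), conjHom g h ∈ Hom P Q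
  factor : ∀ {P Q : Subgroup S} {φ : P →* Q}, φ ∈ Hom P Q →
    ∃ (R : Subgroup S) (h : R ≤ Q) (e : P ≃* R), e.toMonoidHom ∈ Hom P R ∧
      e.symm.toMonoidHom ∈ Hom R P ∧ φ = (Subgroup.inclusion h).comp e.toMonoidHom

namespace FusionSystem

variable {S : Type u} [Group S] (F : FusionSystem S)

theorem inclusion_mem {P Q : Subgroup S} (h : P ≤ Q) : Subgroup.inclusion h ∈ F.Hom P Q := by
  convert F.conj_mem (P := P) (Q := Q) 1 (fun x hx => by simpa using h hx)
  ext x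
  simp [conjHom]

theorem id_mem (P : Subgroup S) : MonoidHom.id P ∈ F.Hom P P := F.inclusion_mem le_rfl

/-- `P` and `Q` are isomorphic objects of `F`. -/
def IsConj (P Q : Subgroup S) : Prop :=
  ∃ e : P ≃* Q, e.toMonoidHom ∈ F.Hom P Q ∧ e.symm.toMonoidHom ∈ F.Hom Q P

/-- `P` is fully centralized in `F`. -/
def IsFullyCentralized (p : ℕ) (P : Subgroup S) : Prop :=
  ∀ Q : Subgroup S, F.IsConj P Q →
    pSize p (Subgroup.centralizer (Q : Set S)) ≤ pSize p (Subgroup.centralizer (P : Set S))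

/-- `P` is fully normalized in `F`. -/
def IsFullyNormalized (p : ℕ) (P : Subgroup S) : Prop :=
  ∀ Q : Subgroup S, F.IsConj P Q →
    pSize p (Subgroup.normalizer (Q : Set S)) ≤ pSize p (Subgroup.normalizer (P : Set S))

/-- `Aut_F(P)`: the automorphisms of the object `P` of `F`. -/
def aut (P : Subgroup S) : Subgroup (MulAut P) where
  carrier := {α | α.toMonoidHom ∈ F.Hom P P ∧ α.symm.toMonoidHom ∈ F.Hom P P}
  one_mem' := ⟨F.id_mem P, F.id_mem P⟩
  mul_mem' ha hb := ⟨F.comp_mem hb.1 ha.1, F.comp_mem ha.2 hb.2⟩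
  inv_mem' ha := ⟨ha.2, ha.1⟩

/-- `Out_F(P) = Aut_F(P) / Aut_P(P)`. -/
abbrev Out (P : Subgroup S) : Type u := F.aut P ⧸ (innerAut P).subgroupOf (F.aut P)

/-- `Out_S(P) = Aut_S(P) / Aut_P(P)`, as a subgroup of `Out_F(P)`. -/
def outS (P : Subgroup S) : Subgroup (F.Out P) :=
  ((autS P).subgroupOf (F.aut P)).map (QuotientGroup.mk' _)

/-- Saturation of a fusion system over a discrete `p`-toral group: the Sylow condition on fully
normalized subgroups, the extension of each `φ` with fully centralized image to `N_φ`, and closure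
under unions of increasing sequences of subgroups. -/
structure IsSaturated (p : ℕ) : Prop where
  sylow : ∀ P : Subgroup S, F.IsFullyNormalized p P → F.IsFullyCentralized p P ∧
    Finite (F.Out P) ∧ ∃ T : Sylow p (F.Out P), (T : Subgroup (F.Out P)) = F.outS P
  extend : ∀ (P : Subgroup S), ∀ φ ∈ F.Hom P ⊤, F.IsFullyCentralized p (homImage φ) →
    ∃ ψ ∈ F.Hom (homExtensionGroup φ) ⊤, ∃ h : P ≤ homExtensionGroup φ, homRestrict ψ h = φ
  union : ∀ P : ℕ → Subgroup S, Monotone P →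
    ∀ φ : (⨆ n, P n : Subgroup S) →* (⊤ : Subgroup S),
      (∀ n, homRestrict φ (le_iSup P n) ∈ F.Hom (P n) ⊤) → φ ∈ F.Hom (⨆ n, P n) ⊤

/-- `P` is `F`-centric: each `F`-conjugate of `P` (including `P`) contains its centralizer. -/
def IsCentric (P : Subgroup S) : Prop :=
  ∀ Q : Subgroup S, F.IsConj P Q → Subgroup.centralizer (Q : Set S) ≤ Q

/-- `P` is `F`-radical: `Out_F(P)` has no nontrivial normal `p`-subgroup. -/
def IsRadical (p : ℕ) (P : Subgroup S) : Prop :=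
  ∀ N : Subgroup (F.Out P), N.Normal → IsPGroup p N → N = ⊥

variable {F} in
/-- A subgroup containing an `F`-centric subgroup is `F`-centric. -/
theorem IsCentric.of_le {P Q : Subgroup S} (hP : F.IsCentric P) (h : P ≤ Q) : F.IsCentric Q := by
  rintro R ⟨e, he, -⟩
  obtain ⟨R', hR', e', he', he'', -⟩ := F.factor (F.comp_mem (F.inclusion_mem h) he)
  exact (Subgroup.centralizer_le (SetLike.coe_subset_coe.2 hR')).trans
    ((hP R' ⟨e', he', he''⟩).trans hR')

/-- The subgroup `P̃` of `N_S(P)`: the intersection of the groups `N_α` for `α ∈ Aut_F(P)`. -/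
def tilde (P : Subgroup S) : Subgroup S := ⨅ α ∈ F.aut P, autExtensionGroup P α

theorem tilde_le_normalizer (P : Subgroup S) :
    F.tilde P ≤ Subgroup.normalizer (P : Set S) := by
  intro y hy
  have h : y ∈ autExtensionGroup P 1 := by
    simp only [tilde, Subgroup.mem_iInf] at hy
    exact hy 1 (one_mem _)
  exact (mem_autExtensionGroup.1 h).1

theorem le_tilde (P : Subgroup S) : P ≤ F.tilde P := by
  intro y hy
  simp only [tilde, Subgroup.mem_iInf]
  intro α _
  refine mem_autExtensionGroup.2 ⟨Subgroup.le_normalizer hy,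
    ⟨⟨(α ⟨y, hy⟩ : P), Subgroup.le_normalizer (α ⟨y, hy⟩).2⟩, ?_⟩⟩
  ext x
  have h : P.normalizerMonoidHom ⟨y, Subgroup.le_normalizer hy⟩ = MulAut.conj ⟨y, hy⟩ := by
    ext z
    simp
  rw [h]
  simp [MulAut.conj_apply]

/-! ### The normalizer fusion system -/

/-- The morphisms `Q → R` of the normalizer fusion system `N_F(P)`, for `Q, R ≤ N_S(P)`: the
`φ ∈ Hom_F(Q, R)` that extend to some `φ' ∈ Hom_F(Q P, R P)` with `φ'(P) = P`. (As `Q` and `R`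
normalize `P`, the products `Q P` and `R P` are the joins `Q ⊔ P` and `R ⊔ P`.) -/
def normalizerHom (P Q R : Subgroup S) : Set (Q →* R) :=
  {φ | φ ∈ F.Hom Q R ∧ ∃ φ' ∈ F.Hom (Q ⊔ P) (R ⊔ P),
    homRestrict φ' le_sup_left = (Subgroup.inclusion le_sup_left).comp φ ∧
    homImage (homRestrict φ' (le_sup_right : P ≤ Q ⊔ P)) = P}

/-- The subgroup `Q ≤ N_S(P)` is `N_F(P)`-centric: each `N_F(P)`-conjugate `R` of `Q` contains its
centralizer in `N_S(P)`. -/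
def IsNormalizerCentric (P Q : Subgroup S) : Prop :=
  ∀ R : Subgroup S, R ≤ Subgroup.normalizer (P : Set S) →
    (∃ e : Q ≃* R, e.toMonoidHom ∈ F.normalizerHom P Q R ∧
      e.symm.toMonoidHom ∈ F.normalizerHom P R Q) →
    Subgroup.centralizer (R : Set S) ⊓ Subgroup.normalizer (P : Set S) ≤ R

variable {F} in
theorem IsCentric.isNormalizerCentric {P Q : Subgroup S} (h : F.IsCentric Q) :
    F.IsNormalizerCentric P Q := by
  rintro R - ⟨e, he, he'⟩
  exact inf_le_left.trans (h R ⟨e, he.1, he'.1⟩)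

theorem homImage_comp_of_eq {P A B C : Subgroup S} (hA : P ≤ A) (hB : P ≤ B) (φ : A →* B)
    (ψ : B →* C) (hφ : homImage (homRestrict φ hA) = P) (hψ : homImage (homRestrict ψ hB) = P) :
    homImage (homRestrict (ψ.comp φ) hA) = P := by
  have hφ' : ∀ x : P, (φ (Subgroup.inclusion hA x) : S) ∈ P := fun x => by
    have h : (φ (Subgroup.inclusion hA x) : S) ∈ homImage (homRestrict φ hA) :=
      Subgroup.mem_map_of_mem B.subtype ⟨x, rfl⟩
    rwa [hφ] at h
  apply le_antisymm
  · rintro _ ⟨_, ⟨x, rfl⟩, rfl⟩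
    have h : (ψ (Subgroup.inclusion hB ⟨_, hφ' x⟩) : S) ∈ homImage (homRestrict ψ hB) :=
      Subgroup.mem_map_of_mem C.subtype ⟨_, rfl⟩
    rw [hψ] at h
    exact h
  · intro y hy
    rw [← hψ] at hy
    obtain ⟨_, ⟨x, rfl⟩, rfl⟩ := hy
    obtain ⟨x, hx⟩ := x
    have hx' := hx
    rw [← hφ] at hx'
    obtain ⟨_, ⟨w, rfl⟩, rfl⟩ := hx'
    exact ⟨_, ⟨w, rfl⟩, rfl⟩

theorem homImage_id {P A : Subgroup S} (hA : P ≤ A) :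
    homImage (homRestrict (MonoidHom.id A) hA) = P := by
  apply le_antisymm
  · rintro _ ⟨_, ⟨x, rfl⟩, rfl⟩
    exact x.2
  · intro y hy
    exact ⟨_, ⟨⟨y, hy⟩, rfl⟩, rfl⟩

theorem normalizerHom_id (P Q : Subgroup S) : MonoidHom.id Q ∈ F.normalizerHom P Q Q := by
  exact ⟨F.id_mem Q, MonoidHom.id _, F.id_mem _, rfl, homImage_id _⟩

theorem normalizerHom_comp {P Q R T : Subgroup S} {φ : Q →* R} {ψ : R →* T}
    (hφ : φ ∈ F.normalizerHom P Q R) (hψ : ψ ∈ F.normalizerHom P R T) :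
    ψ.comp φ ∈ F.normalizerHom P Q T := by
  obtain ⟨h1, φ', h2, h3, h4⟩ := hφ
  obtain ⟨k1, ψ', k2, k3, k4⟩ := hψ
  refine ⟨F.comp_mem h1 k1, ψ'.comp φ', F.comp_mem h2 k2, ?_,
    homImage_comp_of_eq _ le_sup_right _ _ h4 k4⟩
  ext x
  have e1 := DFunLike.congr_fun h3 x
  have e2 := DFunLike.congr_fun k3 (φ x)
  simp only [homRestrict, MonoidHom.comp_apply] at e1 e2 ⊢
  rw [e1, e2]

/-! ### Linking systems -/

/-- The `F`-centric subgroups of `S`. -/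
structure CentricSubgroup where
  /-- The underlying subgroup. -/
  toSubgroup : Subgroup S
  isCentric : F.IsCentric toSubgroup

/-- A centric linking system associated to `F`: a category whose objects are the `F`-centric
subgroups of `S`, with a functor `π` (`proj`) to `F` that is the identity on objects, and
distinguished monomorphisms `δ_P : P → Aut(P)` (`dist`). -/
structure CentricLinkingSystem where
  category : Category.{v} F.CentricSubgroup
  /-- The functor `π` on morphisms. -/
  proj : ∀ {P Q : F.CentricSubgroup}, (P ⟶ Q) → (P.toSubgroup →* Q.toSubgroup)
  proj_id : ∀ P : F.CentricSubgroup, proj (𝟙 P) = MonoidHom.id P.toSubgroup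
  proj_comp : ∀ {P Q R : F.CentricSubgroup} (f : P ⟶ Q) (g : Q ⟶ R),
    proj (f ≫ g) = (proj g).comp (proj f)
  /-- The monomorphisms `δ_P`. -/
  dist : ∀ P : F.CentricSubgroup, P.toSubgroup →* Aut P
  dist_injective : ∀ P : F.CentricSubgroup, Function.Injective (dist P)
  /-- `π` maps `Hom(P, Q)` onto `Hom_F(P, Q)`. -/
  range_proj : ∀ P Q : F.CentricSubgroup,
    Set.range (proj (P := P) (Q := Q)) = F.Hom P.toSubgroup Q.toSubgroup
  /-- `Z(P)` acts freely on `Hom(P, Q)`. -/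
  free : ∀ {P Q : F.CentricSubgroup} (f : P ⟶ Q), ∀ z ∈ Subgroup.center P.toSubgroup,
    (dist P z).hom ≫ f = f → z = 1
  /-- The fibres of `π` are the `Z(P)`-orbits. -/
  proj_eq_iff : ∀ {P Q : F.CentricSubgroup} (f g : P ⟶ Q),
    proj f = proj g ↔ ∃ z ∈ Subgroup.center P.toSubgroup, g = (dist P z).hom ≫ f
  /-- `π(δ_P(g)) = c_g`. -/
  proj_dist : ∀ (P : F.CentricSubgroup) (g : P.toSubgroup),
    proj (dist P g).hom = (MulAut.conj g).toMonoidHom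
  /-- `δ_Q(π(f)(g)) ∘ f = f ∘ δ_P(g)`. -/
  comm : ∀ {P Q : F.CentricSubgroup} (f : P ⟶ Q) (g : P.toSubgroup),
    f ≫ (dist Q (proj f g)).hom = (dist P g).hom ≫ f

variable {F}

namespace CentricLinkingSystem

variable (L : F.CentricLinkingSystem)

/-- The type of objects of the linking system `L`. -/
def Obj (_ : F.CentricLinkingSystem) : Type u := F.CentricSubgroup

instance : Category L.Obj := L.category

variable {L} in
/-- The subgroup of `S` underlying an object of `L`. -/
def Obj.toSubgroup (X : L.Obj) : Subgroup S := CentricSubgroup.toSubgroup X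

/-- The functor `π : L → F` on morphisms. -/
def map {X Y : L.Obj} (f : X ⟶ Y) : X.toSubgroup →* Y.toSubgroup := L.proj f

theorem map_id (X : L.Obj) : L.map (𝟙 X) = MonoidHom.id X.toSubgroup := L.proj_id X

theorem map_comp {X Y Z : L.Obj} (f : X ⟶ Y) (g : Y ⟶ Z) :
    L.map (f ≫ g) = (L.map g).comp (L.map f) := L.proj_comp f g

/-- The objects of the normalizer `N_L(P)` of an `F`-centric subgroup `P` in `L`: the
`N_F(P)`-centric subgroups of `N_S(P)`. -/
structure NormalizerObj (L : F.CentricLinkingSystem) {P : Subgroup S} (hP : F.IsCentric P) where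
  /-- The underlying subgroup. -/
  toSubgroup : Subgroup S
  le_normalizer : toSubgroup ≤ Subgroup.normalizer (P : Set S)
  isCentric : F.IsNormalizerCentric P toSubgroup

variable {P : Subgroup S} {hP : F.IsCentric P}

/-- The subgroup `Q P`, as an object of `L`. -/
def NormalizerObj.prod (Q : L.NormalizerObj hP) : L.Obj :=
  (⟨Q.toSubgroup ⊔ P, hP.of_le le_sup_right⟩ : F.CentricSubgroup)

/-- The morphisms `Q → R` of `N_L(P)`: the `φ ∈ Hom_L(Q P, R P)` such that `π(φ)` restricts to an
element of `Hom_{N_F(P)}(Q, R)` and `π(φ)(P) = P`. -/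
@[ext] structure NormalizerObj.Hom (Q R : L.NormalizerObj hP) where
  /-- The underlying morphism of `L`. -/
  hom : Q.prod ⟶ R.prod
  restrict_mem : ∃ ψ ∈ F.normalizerHom P Q.toSubgroup R.toSubgroup,
    homRestrict (L.map hom) (le_sup_left : Q.toSubgroup ≤ Q.toSubgroup ⊔ P) =
      (Subgroup.inclusion le_sup_left).comp ψ
  image_eq : homImage (homRestrict (L.map hom) (le_sup_right : P ≤ Q.toSubgroup ⊔ P)) = P

/-- The category `N_L(P)`; the composition is that of `L`. -/
instance : Category (L.NormalizerObj hP) where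
  Hom Q R := NormalizerObj.Hom L Q R
  id Q :=
    { hom := 𝟙 Q.prod
      restrict_mem := ⟨MonoidHom.id _, F.normalizerHom_id P _, by rw [L.map_id]; rfl⟩
      image_eq := by rw [L.map_id]; exact homImage_id _ }
  comp {Q R T} f g :=
    { hom := f.hom ≫ g.hom
      restrict_mem := by
        obtain ⟨φ, hφ, h1⟩ := f.restrict_mem
        obtain ⟨ψ, hψ, h2⟩ := g.restrict_mem
        refine ⟨ψ.comp φ, F.normalizerHom_comp hφ hψ, ?_⟩
        rw [L.map_comp]
        refine MonoidHom.ext fun x => ?_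
        exact (congrArg (L.map g.hom) (DFunLike.congr_fun h1 x)).trans
          (DFunLike.congr_fun h2 (φ x))
      image_eq := by
        rw [L.map_comp]
        exact homImage_comp_of_eq _ _ _ _ f.image_eq g.image_eq }
  id_comp f := NormalizerObj.Hom.ext (Category.id_comp f.hom)
  comp_id f := NormalizerObj.Hom.ext (Category.comp_id f.hom)
  assoc f g h := NormalizerObj.Hom.ext (Category.assoc f.hom g.hom h.hom)

/-- The functor `N_L(P) ⥤ L` sending a morphism to its underlying morphism of `L`. -/
def toLinking (hP : F.IsCentric P) : L.NormalizerObj hP ⥤ L.Obj where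
  obj Q := Q.prod
  map f := f.hom
  map_id _ := rfl
  map_comp _ _ := rfl

/-- `P` as an object of `N_L(P)`. -/
def normalizerBase (hP : F.IsCentric P) : L.NormalizerObj hP :=
  ⟨P, Subgroup.le_normalizer, hP.isNormalizerCentric⟩

/-- `P̃` as an object of `N_L(P)`. -/
def normalizerTilde (hP : F.IsCentric P) : L.NormalizerObj hP :=
  ⟨F.tilde P, F.tilde_le_normalizer P, (hP.of_le (F.le_tilde P)).isNormalizerCentric⟩

/-- The full subcategory of the undercategory `P ↓ N_L(P)` on the morphisms `P → Q` of `N_L(P)`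
that are not isomorphisms in `L`. -/
abbrev NonIsoUnder (hP : F.IsCentric P) : Type (max u v) :=
  ObjectProperty.FullSubcategory fun X : Under (L.normalizerBase hP) =>
    ¬ IsIso ((L.toLinking hP).map X.hom)

end CentricLinkingSystem

end FusionSystem

/-- The geometric realization of the nerve of a category. -/
noncomputable abbrev nerveRealization (C : Type u) [Category.{v} C] : TopCat.{max u v} :=
  SSet.toTop.obj (nerve C)

/-! A fully normalized `P` is fully centralized, so saturation extends each `α ∈ Aut_F(P)` to `N_α`,
hence to `P̃`. Conversely, if `ψ` extends `α` to `Q`, then `ψ(y)` induces `α c_y α⁻¹` on `P`, which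
forces `y ∈ N_α`. If `P` is not radical, a nontrivial normal `p`-subgroup of `Out_F(P)` lies in the
Sylow subgroup `Out_S(P)`. A nontrivial class in it is induced by some `y ∉ P`, and all its
conjugates stay in `Out_S(P)`, so `y ∈ P̃` (`lt_tilde`).

The homotopy equivalence holds because both realizations are contractible. On the side of `P̃`, the
identity is initial in the undercategory. On the side of `P`, morphisms of `N_L(P)` out of `P` are
epimorphisms (`epi_of_normal`), so the category of non-isomorphisms under `P` is thin. There `T : (P
→ Q) ↦ (P → Q P̃)` receives a morphism from `P → Q` and one from the fixed object `P → P̃`. Thinness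
makes `T` a functor and both families natural, giving a zigzag `id ⇒ T ⇐ const`. Strictness of `P <
P̃` ensures that `P → P̃` and `P → Q P̃` are not isomorphisms.

The morphisms needed come from `exists_comp_eq`: an extension of `α` to `Q P` maps into `R` as soon
as elements of `R` induce the conjugates `α c_x α⁻¹`, because `P` contains its centralizer. For `x ∈
P̃` these elements can be found in `P̃` itself (`mem_tilde_of_conj`).

The topological input is that a natural transformation induces a homotopy (`homotopic_of_natTrans`).
It is proved by cutting each prism `Δⁿ × I` along the maximal chains of `[n] × [1]`, with explicit
barycentric weights that are natural in `[n]`. -/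

/-! ### Points of geometric realizations -/

section Realization

open Simplicial Opposite

namespace SSet

/-- The characteristic map `Δⁿ → |Y|` of an `n`-simplex `y` of `Y`. -/
noncomputable def charMap (Y : SSet.{u}) {n : ℕ} (y : Y _⦋n⦌) :
    C(_root_.stdSimplex ℝ (Fin (n + 1)), |Y|) :=
  TopCat.toSSetObjEquiv _ _ ((sSetTopAdj.unit.app Y).app (op ⦋n⦌) y)

theorem charMap_map (Y : SSet.{u}) {m n : ℕ} (f : ⦋m⦌ ⟶ ⦋n⦌) (y : Y _⦋n⦌)
    (t : _root_.stdSimplex ℝ (Fin (m + 1))) :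
    Y.charMap (Y.map f.op y) t = Y.charMap y (_root_.stdSimplex.map f t) := by
  have h := NatTrans.naturality_apply (sSetTopAdj.unit.app Y) f.op y
  exact (congrArg (fun k => TopCat.toSSetObjEquiv |Y| (op ⦋m⦌) k t) h).trans
    (TopCat.toSSetObjEquiv_naturality_apply (X := |Y|) f ((sSetTopAdj.unit.app Y).app (op ⦋n⦌) y) t)

theorem toTop_map_charMap {X Y : SSet.{u}} (g : X ⟶ Y) {n : ℕ} (x : X _⦋n⦌)
    (t : _root_.stdSimplex ℝ (Fin (n + 1))) :
    toTop.map g (X.charMap x t) = Y.charMap (g.app _ x) t := by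
  have h := congrArg (fun k => TopCat.toSSetObjEquiv _ _ (k.app (op ⦋n⦌) x) t)
    (sSetTopAdj.unit.naturality g)
  exact h.symm

/-- A compatible family of maps `Δⁿ → Z` defines a map `|X| → Z`. -/
noncomputable def toTopDesc {X : SSet.{u}} {Z : TopCat.{u}}
    (c : ∀ n : ℕ, X _⦋n⦌ → C(_root_.stdSimplex ℝ (Fin (n + 1)), Z))
    (hc : ∀ (m n : ℕ) (f : ⦋m⦌ ⟶ ⦋n⦌) (x : X _⦋n⦌) (t : _root_.stdSimplex ℝ (Fin (m + 1))),
      c m (X.map f.op x) t = c n x (_root_.stdSimplex.map f t)) : |X| ⟶ Z :=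
  (sSetTopAdj.homEquiv X Z).symm
    { app := fun n => ↾fun x => (TopCat.toSSetObjEquiv Z n).symm (c n.unop.len x)
      naturality := by
        intro n m f
        ext x
        refine (TopCat.toSSetObjEquiv Z m).injective (ContinuousMap.ext fun t => ?_)
        exact hc _ _ f.unop x t }

theorem toTopDesc_charMap {X : SSet.{u}} {Z : TopCat.{u}}
    (c : ∀ n : ℕ, X _⦋n⦌ → C(_root_.stdSimplex ℝ (Fin (n + 1)), Z))
    (hc : ∀ (m n : ℕ) (f : ⦋m⦌ ⟶ ⦋n⦌) (x : X _⦋n⦌) (t : _root_.stdSimplex ℝ (Fin (m + 1))),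
      c m (X.map f.op x) t = c n x (_root_.stdSimplex.map f t))
    {n : ℕ} (x : X _⦋n⦌) (t : _root_.stdSimplex ℝ (Fin (n + 1))) :
    toTopDesc c hc (X.charMap x t) = c n x t := by
  have h := (sSetTopAdj.homEquiv X Z).apply_symm_apply
    { app := fun n => ↾fun x => (TopCat.toSSetObjEquiv Z n).symm (c n.unop.len x)
      naturality := by
        intro n m f
        ext x
        refine (TopCat.toSSetObjEquiv Z m).injective (ContinuousMap.ext fun t => ?_)
        exact hc _ _ f.unop x t }
  rw [Adjunction.homEquiv_unit] at h
  exact congrArg (fun k => TopCat.toSSetObjEquiv _ _ (k.app (op ⦋n⦌) x) t) h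

/-- By adjunction a map out of `|X|` is a simplicial map into the singular set of `Z`, so no cell
structure on `|X|` is needed. -/
theorem toTop_hom_ext {X : SSet.{u}} {Z : TopCat.{u}} {f g : |X| ⟶ Z}
    (h : ∀ (n : ℕ) (x : X _⦋n⦌) (t : _root_.stdSimplex ℝ (Fin (n + 1))),
      f (X.charMap x t) = g (X.charMap x t)) : f = g := by
  refine (sSetTopAdj.homEquiv X Z).injective ?_
  ext n x
  refine (TopCat.toSSetObjEquiv Z n).injective (ContinuousMap.ext fun t => ?_)
  simp only [Adjunction.homEquiv_unit]
  exact h n.unop.len x t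

end SSet

end Realization

/-! ### Barycentric weights -/

namespace stdSimplex

variable {X Y : Type*} [Fintype X] [Fintype Y]

theorem map_apply [DecidableEq Y] (f : X → Y) (s : stdSimplex ℝ X) (y : Y) :
    map f s y = ∑ x with f x = y, s x := by
  rw [map_coe, FunOnFinite.linearMap_apply_apply]

theorem sum_filter_map (f : X → Y) (s : stdSimplex ℝ X) (p : Y → Prop) [DecidablePred p] :
    ∑ y with p y, map f s y = ∑ x with p (f x), s x := by
  classical
  simp only [map_apply]
  rw [← Finset.sum_fiberwise_of_maps_to (s := {x | p (f x)}) (t := {y | p y}) (g := f)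
    (fun x hx => by simpa using hx)]
  refine Finset.sum_congr rfl fun y hy => Finset.sum_congr ?_ fun _ _ => rfl
  ext x
  simp only [Finset.mem_filter, Finset.mem_univ, true_and] at hy ⊢
  exact ⟨fun h => ⟨h ▸ hy, h⟩, fun h => h.2⟩

theorem map_apply_of_injective {f : X → Y} (hf : Function.Injective f) (s : stdSimplex ℝ X)
    (x : X) : map f s (f x) = s x := by
  classical
  rw [map_apply, Finset.sum_eq_single x]
  · intro b hb hbx
    exact absurd (hf (Finset.mem_filter.1 hb).2) hbx
  · intro h
    simp at h

theorem map_injective {f : X → Y} (hf : Function.Injective f) :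
    Function.Injective (map (S := ℝ) f) := fun s t h => by
  ext x
  rw [← map_apply_of_injective hf s, h, map_apply_of_injective hf]

theorem mem_range_of_map_apply_ne_zero {f : X → Y} {s : stdSimplex ℝ X} {y : Y}
    (h : map f s y ≠ 0) : y ∈ Set.range f := by
  classical
  rw [map_apply] at h
  obtain ⟨x, hx, -⟩ := Finset.exists_ne_zero_of_sum_ne_zero h
  exact ⟨x, (Finset.mem_filter.1 hx).2⟩

/-- Weights are nonnegative, so nothing cancels within a fibre. -/
theorem map_apply_ne_zero {f : X → Y} {s : stdSimplex ℝ X} {x : X} (h : s x ≠ 0) :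
    map f s (f x) ≠ 0 := by
  classical
  rw [map_apply]
  refine ne_of_gt (lt_of_lt_of_le (lt_of_le_of_ne (zero_le s x) h.symm) ?_)
  exact Finset.single_le_sum (f := fun z => s z) (fun z _ => zero_le s z) (by simp)

/-- The pullback of weights supported in the range of an injective map. -/
def comap (f : X → Y) (hf : Function.Injective f) (w : stdSimplex ℝ Y)
    (hw : ∀ y, w y ≠ 0 → y ∈ Set.range f) : stdSimplex ℝ X :=
  ⟨fun x => w (f x), fun x => zero_le w (f x), by
    classical
    rw [← sum_eq_one w, ← Finset.sum_image (s := Finset.univ) (f := fun y => w y)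
      (fun a _ b _ h => hf h)]
    refine Finset.sum_subset (Finset.subset_univ _) fun y _ hy => ?_
    by_contra h
    obtain ⟨x, rfl⟩ := hw y h
    simp at hy⟩

theorem map_comap (f : X → Y) (hf : Function.Injective f) (w : stdSimplex ℝ Y)
    (hw : ∀ y, w y ≠ 0 → y ∈ Set.range f) : map f (comap f hf w hw) = w := by
  ext y
  by_cases hy : y ∈ Set.range f
  · obtain ⟨x, rfl⟩ := hy
    exact map_apply_of_injective hf _ _
  · rw [show w y = 0 from not_not.1 fun h => hy (hw y h)]
    exact not_not.1 fun h => hy (mem_range_of_map_apply_ne_zero h)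

end stdSimplex

section Chains

open Simplicial Opposite

variable {D : Type u} [Category.{v} D] {Q : Type} [PartialOrder Q]

/-- The simplex of the nerve of `D` obtained from a chain in `Q` and a functor `Q ⥤ D`. -/
def nerveChain (G : Q ⥤ D) {a : ℕ} (σ : Fin (a + 1) →o Q) : (nerve D) _⦋a⦌ :=
  (σ.monotone.functor ⋙ G : Fin (a + 1) ⥤ D)

theorem charMap_nerveChain_comp (G : Q ⥤ D) {a b : ℕ} (σ : Fin (a + 1) →o Q)
    (f : Fin (b + 1) →o Fin (a + 1)) (t : stdSimplex ℝ (Fin (b + 1))) :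
    (nerve D).charMap (nerveChain G (σ.comp f)) t =
      (nerve D).charMap (nerveChain G σ) (stdSimplex.map f t) :=
  (nerve D).charMap_map (SimplexCategory.mkHom f) (nerveChain G σ) t

/-- A point of the realization given by a chain depends only on its weights. -/
theorem charMap_nerveChain_eq [Fintype Q] (G : Q ⥤ D) {a c : ℕ} (σ : Fin (a + 1) →o Q)
    (e : Fin (c + 1) →o Q) (he : Function.Injective e) (t : stdSimplex ℝ (Fin (a + 1)))
    (u : stdSimplex ℝ (Fin (c + 1))) (h : stdSimplex.map σ t = stdSimplex.map e u) :
    (nerve D).charMap (nerveChain G σ) t = (nerve D).charMap (nerveChain G e) u := by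
  classical
  -- Vertices of weight zero are discarded: `i` enumerates the support of `t`, and on it `σ` factors
  -- through `e`.
  let A : Finset (Fin (a + 1)) := {j | t j ≠ 0}
  have hA : A.Nonempty := by
    by_contra hA
    have h1 := stdSimplex.sum_eq_one t
    rw [Finset.sum_eq_zero fun j _ => ?_] at h1
    · exact zero_ne_one h1
    · by_contra hj
      exact hA ⟨j, by simpa [A] using hj⟩
  obtain ⟨b, hb⟩ := Nat.exists_eq_succ_of_ne_zero hA.card_pos.ne'
  let i : Fin (b + 1) ↪o Fin (a + 1) := A.orderEmbOfFin hb
  have hi : ∀ j, t j ≠ 0 → j ∈ Set.range i := fun j hj => by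
    rw [Finset.range_orderEmbOfFin]
    simpa [A] using hj
  let t' := stdSimplex.comap i i.injective t hi
  have ht' : stdSimplex.map i t' = t := stdSimplex.map_comap _ _ _ _
  -- A vertex of nonzero weight keeps nonzero weight in `Q`, and by `h` such points lie in the range
  -- of `e`.
  have hex : ∀ j, ∃ k, e k = σ (i j) := fun j => by
    have hj : t (i j) ≠ 0 := by
      have : i j ∈ A := Finset.orderEmbOfFin_mem A hb j
      simpa [A] using this
    have := stdSimplex.map_apply_ne_zero (f := σ) hj
    rw [h] at this
    exact stdSimplex.mem_range_of_map_apply_ne_zero this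
  choose q hq using hex
  have hqm : Monotone q := fun j k hjk => by
    by_contra hlt
    have h1 : e (q k) ≤ e (q j) := e.monotone (not_le.1 hlt).le
    rw [hq, hq] at h1
    have h2 : σ (i j) = σ (i k) := le_antisymm (σ.monotone (i.monotone hjk)) h1
    rw [← hq, ← hq] at h2
    exact hlt (he h2).le
  let q' : Fin (b + 1) →o Fin (c + 1) := ⟨q, hqm⟩
  have hcomp : σ.comp i.toOrderHom = e.comp q' := by
    ext j : 2
    exact (hq j).symm
  have hu : stdSimplex.map q' t' = u := by
    apply stdSimplex.map_injective he
    rw [← h, ← ht', stdSimplex.map_comp_apply, stdSimplex.map_comp_apply]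
    exact congrArg (fun f => stdSimplex.map f t') (funext fun j => hq j)
  rw [← hu, ← charMap_nerveChain_comp, ← hcomp, charMap_nerveChain_comp]
  exact congrArg _ ht'.symm

end Chains

/-! ### The prism decomposition -/

section Prism

open Simplicial Opposite

/-- The partially ordered set `[n] × [1]`. -/
def Prism (n : ℕ) : Type := Fin (n + 1) × Fin 2

namespace Prism

instance (n : ℕ) : PartialOrder (Prism n) := inferInstanceAs (PartialOrder (Fin (n + 1) × Fin 2))

instance (n : ℕ) : Fintype (Prism n) := inferInstanceAs (Fintype (Fin (n + 1) × Fin 2))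

/-- The weighted partial sum `∑_{i ∈ A} t i`. -/
def partialSum {n : ℕ} (t : stdSimplex ℝ (Fin (n + 1))) (A : Finset (Fin (n + 1))) : ℝ :=
  ∑ i ∈ A, t i

theorem partialSum_mono {n : ℕ} (t : stdSimplex ℝ (Fin (n + 1))) {A B : Finset (Fin (n + 1))}
    (h : A ⊆ B) : partialSum t A ≤ partialSum t B :=
  Finset.sum_le_sum_of_subset_of_nonneg h fun i _ _ => stdSimplex.zero_le t i

theorem partialSum_Iic {n : ℕ} (t : stdSimplex ℝ (Fin (n + 1))) (j : Fin (n + 1)) :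
    partialSum t (Finset.Iic j) = t j + partialSum t (Finset.Iio j) := by
  unfold partialSum
  rw [← Finset.Iio_insert, Finset.sum_insert (by simp)]

theorem continuous_partialSum {n : ℕ} (A : Finset (Fin (n + 1))) :
    Continuous fun t : stdSimplex ℝ (Fin (n + 1)) => partialSum t A :=
  continuous_finsetSum _ fun i _ => (continuous_apply i).comp continuous_subtype_val

/-- The cut function: `min s` on the bottom and `max s` on the top of the prism. -/
def cut (ε : Fin 2) (s x : ℝ) : ℝ := if ε = 0 then min s x else max s x

theorem cut_mono (ε : Fin 2) (s : ℝ) : Monotone (cut ε s) := fun x y h => by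
  unfold cut
  split_ifs
  · exact min_le_min_left s h
  · exact max_le_max_left s h

/-- The barycentric weights of the point `(s, t)` of the prism. -/
def weightFun {n : ℕ} (s : ℝ) (t : stdSimplex ℝ (Fin (n + 1))) (q : Prism n) : ℝ :=
  cut q.2 s (partialSum t (Finset.Iic q.1)) - cut q.2 s (partialSum t (Finset.Iio q.1))

/-- A lower set is an initial segment, so the sum telescopes. For `s ∈ [0, 1]` the bottom carries
total mass `s` and the top `1 - s`. -/
theorem sum_weightFun_of_isLowerSet {n : ℕ} (s : ℝ) (t : stdSimplex ℝ (Fin (n + 1))) (ε : Fin 2)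
    (A : Finset (Fin (n + 1))) (hA : IsLowerSet (A : Set (Fin (n + 1)))) :
    ∑ j ∈ A, weightFun s t (j, ε) = cut ε s (partialSum t A) - cut ε s 0 := by
  induction A using Finset.induction_on_max with
  | empty => simp [partialSum]
  | insert a A ha ih =>
    have h : A = Finset.Iio a := by
      ext x
      rw [Finset.mem_Iio]
      refine ⟨ha x, fun hx => ?_⟩
      have : x ∈ insert a A := hA hx.le (Finset.mem_insert_self a A)
      exact (Finset.mem_insert.1 this).resolve_left hx.ne
    subst h
    rw [Finset.sum_insert (by simp), ih (by simpa using isLowerSet_Iio a), Finset.Iio_insert]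
    simp [weightFun]

/-- The barycentric weights of the point `(s, t)` of the prism. -/
def weight {n : ℕ} (s : unitInterval) (t : stdSimplex ℝ (Fin (n + 1))) :
    stdSimplex ℝ (Prism n) :=
  ⟨weightFun s t, fun q => sub_nonneg.2 (cut_mono _ _ (partialSum_mono t
      (Finset.Iio_subset_Iic_self))), by
    -- Since `min s x + max s x = s + x`, the two weights over `j` add up to an increment of the
    -- partial sums.
    have h1 : ∀ j : Fin (n + 1), ∑ ε : Fin 2, weightFun (n := n) s t (j, ε) = t j := fun j => by
      have h2 := partialSum_Iic t j
      have h3 := min_add_max (s : ℝ) (partialSum t (Finset.Iic j))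
      have h4 := min_add_max (s : ℝ) (partialSum t (Finset.Iio j))
      simp only [weightFun, cut, Fin.sum_univ_two, Fin.isValue, one_ne_zero, if_true, if_false]
      linarith
    have h5 : ∑ q : Prism n, weightFun s t q =
        ∑ j : Fin (n + 1), ∑ ε : Fin 2, weightFun (n := n) s t (j, ε) :=
      Fintype.sum_prod_type (fun q : Fin (n + 1) × Fin 2 => weightFun (n := n) s t q)
    rw [h5, Finset.sum_congr rfl fun j _ => h1 j]
    exact stdSimplex.sum_eq_one t⟩

theorem continuous_weight (n : ℕ) :
    Continuous fun z : unitInterval × stdSimplex ℝ (Fin (n + 1)) => weight z.1 z.2 := by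
  refine Continuous.subtype_mk (continuous_pi fun q => ?_) _
  have h1 := (continuous_partialSum (Finset.Iic q.1)).comp
    (continuous_snd (X := unitInterval) (Y := stdSimplex ℝ (Fin (n + 1))))
  have h2 := (continuous_partialSum (Finset.Iio q.1)).comp
    (continuous_snd (X := unitInterval) (Y := stdSimplex ℝ (Fin (n + 1))))
  have h3 : Continuous fun z : unitInterval × stdSimplex ℝ (Fin (n + 1)) => (z.1 : ℝ) :=
    continuous_subtype_val.comp continuous_fst
  unfold weightFun cut
  split_ifs
  · exact (h3.min h1).sub (h3.min h2)
  · exact (h3.max h1).sub (h3.max h2)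

/-- A single weight is the difference of the sums over `Iic j` and `Iio j`. -/
theorem weights_ext {n : ℕ} {w w' : stdSimplex ℝ (Prism n)}
    (h : ∀ (ε : Fin 2) (A : Finset (Fin (n + 1))), IsLowerSet (A : Set (Fin (n + 1))) →
      ∑ j ∈ A, w (j, ε) = ∑ j ∈ A, w' (j, ε)) : w = w' := by
  ext ⟨j, ε⟩
  have h1 := h ε (Finset.Iic j) (by simpa using isLowerSet_Iic j)
  have h2 := h ε (Finset.Iio j) (by simpa using isLowerSet_Iio j)
  rw [← Finset.Iio_insert, Finset.sum_insert (by simp), Finset.sum_insert (by simp), h2] at h1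
  exact add_right_cancel h1

/-- The map of prisms induced by a map of simplices. -/
def mapHom {m n : ℕ} (f : Fin (m + 1) →o Fin (n + 1)) : Prism m →o Prism n :=
  ⟨fun q => (f q.1, q.2), fun _ _ h => ⟨f.monotone h.1, h.2⟩⟩

/-- The preimage of a lower set under a monotone map is a lower set, so both sides have the same
telescoped sums. -/
theorem map_weight {m n : ℕ} (f : Fin (m + 1) →o Fin (n + 1)) (s : unitInterval)
    (t : stdSimplex ℝ (Fin (m + 1))) :
    stdSimplex.map (mapHom f) (weight s t) = weight s (stdSimplex.map f t) := by
  classical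
  refine weights_ext fun ε A hA => ?_
  have h1 := sum_weightFun_of_isLowerSet s (stdSimplex.map f t) ε A hA
  have h2 := sum_weightFun_of_isLowerSet s t ε {j | f j ∈ A} (by
    intro a b hab ha
    exact Finset.mem_filter.2 ⟨Finset.mem_univ b, hA (f.monotone hab) (Finset.mem_filter.1 ha).2⟩)
  have h3 : partialSum (stdSimplex.map f t) A = partialSum t {j | f j ∈ A} := by
    have := stdSimplex.sum_filter_map f t (· ∈ A)
    simpa [partialSum] using this
  -- Sums over one end are rewritten as filtered sums over the whole prism, the form
  -- `stdSimplex.sum_filter_map` handles.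
  have h4 : ∀ (k : ℕ) (B : Finset (Fin (k + 1))) (w : stdSimplex ℝ (Prism k)),
      ∑ j ∈ B, w (j, ε) = ∑ q : Prism k with q.1 ∈ B ∧ q.2 = ε, w q := fun k B w => by
    refine Finset.sum_bij' (fun j _ => ((j, ε) : Prism k)) (fun q _ => q.1) ?_ ?_ ?_ ?_ ?_
    · intro j hj
      exact Finset.mem_filter.2 ⟨Finset.mem_univ _, hj, rfl⟩
    · intro q hq
      exact (Finset.mem_filter.1 hq).2.1
    · intro j hj
      rfl
    · intro q hq
      exact Prod.ext rfl (Finset.mem_filter.1 hq).2.2.symm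
    · intro j hj
      rfl
  rw [h4, stdSimplex.sum_filter_map]
  refine Eq.trans ?_ (h2.trans ((congrArg (fun x => cut ε s x - cut ε s 0) h3).symm.trans h1.symm))
  refine Eq.trans ?_ (h4 m {j | f j ∈ A} (weight s t)).symm
  refine Finset.sum_congr ?_ fun _ _ => rfl
  ext q
  rw [Finset.mem_filter, Finset.mem_filter, Finset.mem_filter]
  simp only [Finset.mem_univ, true_and]
  rfl

/-- The `k`-th maximal chain of the prism. -/
def chain {n : ℕ} (k : Fin (n + 1)) : Fin (n + 1 + 1) →o Prism n :=
  ⟨fun j => (k.predAbove j, if j ≤ k.castSucc then 0 else 1), fun i j h => by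
    refine ⟨Fin.predAbove_right_monotone k h, ?_⟩
    dsimp only
    split_ifs with h1 h2
    · exact le_rfl
    · exact Fin.zero_le _
    · exact absurd (h.trans ‹_›) h1
    · exact le_rfl⟩

/-- The chain runs along the bottom up to `(k, 0)`, steps up to `(k, 1)`, and continues along the
top. -/
theorem chain_castSucc {n : ℕ} {i k : Fin (n + 1)} (h : i ≤ k) :
    chain k i.castSucc = ((i, 0) : Prism n) := by
  refine Prod.ext (Fin.predAbove_castSucc_of_le _ _ h) ?_
  exact if_pos (Fin.castSucc_le_castSucc_iff.2 h)

theorem chain_succ {n : ℕ} {i k : Fin (n + 1)} (h : k ≤ i) :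
    chain k i.succ = ((i, 1) : Prism n) := by
  refine Prod.ext (Fin.predAbove_succ_of_le _ _ h) ?_
  exact if_neg (not_le.2 (Fin.castSucc_lt_succ_iff.2 h))

theorem chain_injective {n : ℕ} (k : Fin (n + 1)) : Function.Injective (chain k) := by
  have key : ∀ j : Fin (n + 1 + 1), (∃ i : Fin (n + 1), i ≤ k ∧ j = i.castSucc) ∨
      ∃ i : Fin (n + 1), k ≤ i ∧ j = i.succ := fun j => by
    rcases le_or_gt j k.castSucc with h | h
    · refine Or.inl ⟨⟨j, ?_⟩, ?_, ?_⟩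
      · exact lt_of_le_of_lt h k.2
      · exact h
      · rfl
    · refine Or.inr ⟨j.pred (Fin.ne_zero_of_lt h), ?_, (Fin.succ_pred _ _).symm⟩
      rw [Fin.le_pred_iff]
      exact Fin.castSucc_lt_iff_succ_le.1 h
  intro a b hab
  obtain ⟨i, hi, rfl⟩ | ⟨i, hi, rfl⟩ := key a <;> obtain ⟨j, hj, rfl⟩ | ⟨j, hj, rfl⟩ := key b <;>
    simp only [chain_castSucc, chain_succ, hi, hj] at hab
  · exact congrArg Fin.castSucc (Prod.ext_iff.1 hab).1
  · exact absurd (Prod.ext_iff.1 hab).2 (by simp)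
  · exact absurd (Prod.ext_iff.1 hab).2 (by simp)
  · exact congrArg Fin.succ (Prod.ext_iff.1 hab).1

/-- The closed region of the prism spanned by the `k`-th maximal chain. -/
def region (n : ℕ) (k : Fin (n + 1)) : Set (unitInterval × stdSimplex ℝ (Fin (n + 1))) :=
  {z | partialSum z.2 (Finset.Iio k) ≤ z.1 ∧ (z.1 : ℝ) ≤ partialSum z.2 (Finset.Iic k)}

theorem isClosed_region (n : ℕ) (k : Fin (n + 1)) : IsClosed (region n k) :=
  (isClosed_le ((continuous_partialSum _).comp continuous_snd)
    (continuous_subtype_val.comp continuous_fst)).inter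
    (isClosed_le (continuous_subtype_val.comp continuous_fst)
      ((continuous_partialSum _).comp continuous_snd))

/-- Take the largest `k` whose partial sum below `k` is at most `s`. Its maximality, or total mass
one when `k` is last, gives the other inequality. -/
theorem exists_mem_region {n : ℕ} (z : unitInterval × stdSimplex ℝ (Fin (n + 1))) :
    ∃ k, z ∈ region n k := by
  classical
  let A : Finset (Fin (n + 1)) := {k | partialSum z.2 (Finset.Iio k) ≤ z.1}
  have hA : A.Nonempty := ⟨0, by
    have : (Finset.Iio 0 : Finset (Fin (n + 1))) = ∅ := by ext x; simp
    refine Finset.mem_filter.2 ⟨Finset.mem_univ _, ?_⟩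
    rw [this]
    exact z.1.2.1⟩
  refine ⟨A.max' hA, (Finset.mem_filter.1 (A.max'_mem hA)).2, ?_⟩
  generalize hk : A.max' hA = k
  induction k using Fin.lastCases with
  | last =>
    have : (Finset.Iic (Fin.last n) : Finset (Fin (n + 1))) = Finset.univ := by
      ext x; simp [Fin.le_last]
    rw [this]
    exact z.1.2.2.trans_eq (stdSimplex.sum_eq_one z.2).symm
  | cast k =>
    by_contra h
    have : (Finset.Iio k.succ : Finset (Fin (n + 1))) = Finset.Iic k.castSucc := by
      ext x
      rw [Finset.mem_Iio, Finset.mem_Iic, Fin.lt_def, Fin.le_def]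
      simp
    have h1 : k.succ ∈ A := by
      simp only [A, Finset.mem_filter, Finset.mem_univ, true_and, this]
      exact (not_le.1 h).le
    have h2 := A.le_max' _ h1
    rw [hk] at h2
    exact absurd h2 (not_le.2 Fin.castSucc_lt_succ)

/-- Off the chain the cut function is constant on the increment: bottom vertices after `k` have both
partial sums at least `s`, top vertices before `k` both at most `s`. -/
theorem mem_range_chain_of_mem_region {n : ℕ} {k : Fin (n + 1)}
    {z : unitInterval × stdSimplex ℝ (Fin (n + 1))} (hz : z ∈ region n k) (q : Prism n)
    (hq : weight z.1 z.2 q ≠ 0) : q ∈ Set.range (chain k) := by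
  obtain ⟨i, ε⟩ := q
  have h0 : weightFun (n := n) z.1 z.2 (i, ε) ≠ 0 := hq
  obtain rfl | rfl : ε = 0 ∨ ε = 1 := by omega
  · refine ⟨i.castSucc, chain_castSucc (not_lt.1 fun h => h0 ?_)⟩
    have h1 : (z.1 : ℝ) ≤ partialSum z.2 (Finset.Iio i) := hz.2.trans
      (partialSum_mono _ fun x hx => Finset.mem_Iio.2 ((Finset.mem_Iic.1 hx).trans_lt h))
    have h2 := h1.trans (partialSum_mono z.2 Finset.Iio_subset_Iic_self)
    simp [weightFun, cut, h1, h2]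
  · refine ⟨i.succ, chain_succ (not_lt.1 fun h => h0 ?_)⟩
    have h1 : partialSum z.2 (Finset.Iic i) ≤ (z.1 : ℝ) := le_trans
      (partialSum_mono _ fun x hx => Finset.mem_Iio.2 ((Finset.mem_Iic.1 hx).trans_lt h)) hz.1
    have h2 := (partialSum_mono z.2 (Finset.Iio_subset_Iic_self (a := i))).trans h1
    simp [weightFun, cut, h1, h2]

variable {D : Type u} [Category.{v} D]

/-- The map from the prism to the realization of the nerve of `D` defined by a functor. -/
noncomputable def realizationFun {n : ℕ} (G : Prism n ⥤ D)
    (z : unitInterval × stdSimplex ℝ (Fin (n + 1))) : nerveRealization D :=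
  (nerve D).charMap (nerveChain G (chain (exists_mem_region z).choose))
    (stdSimplex.comap _ (chain_injective _) (weight z.1 z.2)
      (mem_range_chain_of_mem_region (exists_mem_region z).choose_spec))

/-- The region chosen in `realizationFun` is immaterial: any chain carrying the right weights, even
with repetitions, gives the same point. -/
theorem charMap_eq_realizationFun {n : ℕ} (G : Prism n ⥤ D)
    (z : unitInterval × stdSimplex ℝ (Fin (n + 1))) {a : ℕ} (σ : Fin (a + 1) →o Prism n)
    (t : stdSimplex ℝ (Fin (a + 1))) (h : stdSimplex.map σ t = weight z.1 z.2) :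
    (nerve D).charMap (nerveChain G σ) t = realizationFun G z :=
  charMap_nerveChain_eq G _ _ (chain_injective _) _ _ (by rw [stdSimplex.map_comap, h])

/-- Finitely many closed regions cover the prism, and on each the chain can be held fixed. -/
theorem continuous_realizationFun {n : ℕ} (G : Prism n ⥤ D) :
    Continuous (realizationFun G) := by
  refine LocallyFinite.continuous (f := region n) (locallyFinite_of_finite _)
    (Set.eq_univ_of_forall fun z => Set.mem_iUnion.2 (exists_mem_region z))
    (isClosed_region n) fun k => ?_
  rw [continuousOn_iff_continuous_domRestrict]
  have h : Continuous fun z : region n k => (nerve D).charMap (nerveChain G (chain k))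
      (stdSimplex.comap _ (chain_injective k) (weight z.1.1 z.1.2)
        (mem_range_chain_of_mem_region z.2)) := by
    refine (ContinuousMap.continuous _).comp (Continuous.subtype_mk (continuous_pi fun j => ?_) _)
    exact (continuous_apply (chain k j)).comp (continuous_subtype_val.comp
      ((continuous_weight n).comp continuous_subtype_val))
  refine h.congr fun z => ?_
  exact charMap_eq_realizationFun G z.1 _ _ (stdSimplex.map_comap _ _ _ _)

end Prism

end Prism

/-! ### Natural transformations and homotopies -/

section NaturalTransformation

open Simplicial Opposite

namespace Prism

/-- The inclusion of an end of the prism. -/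
def face (n : ℕ) (ε : Fin 2) : Fin (n + 1) →o Prism n :=
  ⟨fun j => (j, ε), fun _ _ h => ⟨h, le_rfl⟩⟩

theorem map_face_eq_weight {n : ℕ} (t : stdSimplex ℝ (Fin (n + 1))) (s : unitInterval) (ε : Fin 2)
    (h0 : ∀ j, weightFun s t (j, ε) = t j) (h1 : ∀ j δ, δ ≠ ε → weightFun s t (j, δ) = 0) :
    stdSimplex.map (face n ε) t = weight s t := by
  ext ⟨j, δ⟩
  by_cases h : δ = ε
  · subst h
    exact (stdSimplex.map_apply_of_injective (f := face n δ)
      (fun a b hab => (Prod.ext_iff.1 hab).1) t j).trans (h0 j).symm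
  · refine Eq.trans ?_ (h1 j δ h).symm
    by_contra hne
    obtain ⟨i, hi⟩ := stdSimplex.mem_range_of_map_apply_ne_zero hne
    exact h (Prod.ext_iff.1 hi).2.symm

theorem partialSum_nonneg {n : ℕ} (t : stdSimplex ℝ (Fin (n + 1))) (A : Finset (Fin (n + 1))) :
    0 ≤ partialSum t A :=
  Finset.sum_nonneg fun i _ => stdSimplex.zero_le t i

theorem partialSum_le_one {n : ℕ} (t : stdSimplex ℝ (Fin (n + 1))) (A : Finset (Fin (n + 1))) :
    partialSum t A ≤ 1 :=
  (partialSum_mono t (Finset.subset_univ A)).trans_eq (stdSimplex.sum_eq_one t)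

/-- At time `0` all mass is on the top, so the homotopy built from these weights runs from top to
bottom. -/
theorem map_face_one {n : ℕ} (t : stdSimplex ℝ (Fin (n + 1))) :
    stdSimplex.map (face n 1) t = weight 0 t := by
  refine map_face_eq_weight t 0 1 (fun j => ?_) (fun j δ hδ => ?_)
  · simp [weightFun, cut, partialSum_nonneg]
    simp [partialSum_Iic t j]
  · obtain rfl : δ = 0 := by omega
    simp [weightFun, cut, partialSum_nonneg]

theorem map_face_zero {n : ℕ} (t : stdSimplex ℝ (Fin (n + 1))) :
    stdSimplex.map (face n 0) t = weight 1 t := by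
  refine map_face_eq_weight t 1 0 (fun j => ?_) (fun j δ hδ => ?_)
  · simp [weightFun, cut, partialSum_le_one]
    simp [partialSum_Iic t j]
  · obtain rfl : δ = 1 := by omega
    simp [weightFun, cut, partialSum_le_one]

end Prism

variable {C D : Type u} [Category.{v} C] [Category.{v} D]

/-- The functor on the prism defined by a natural transformation and a composable sequence. -/
def prismFunctor (K : Fin 2 ⥤ C ⥤ D) {n : ℕ} (x : ComposableArrows C n) : Prism n ⥤ D where
  obj q := (K.obj q.2).obj (x.obj q.1)
  map {q r} h := (K.map (homOfLE (leOfHom h).2)).app _ ≫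
    (K.obj r.2).map (x.map (homOfLE (leOfHom h).1))
  map_id q := by
    have h1 : homOfLE (le_refl q.2) = 𝟙 q.2 := rfl
    have h2 : homOfLE (le_refl q.1) = 𝟙 q.1 := rfl
    rw [h1, h2]
    simp
  map_comp {q r t} h k := by
    have h1 : homOfLE (leOfHom (h ≫ k)).2 = homOfLE (leOfHom h).2 ≫ homOfLE (leOfHom k).2 := rfl
    have h2 : homOfLE (leOfHom (h ≫ k)).1 = homOfLE (leOfHom h).1 ≫ homOfLE (leOfHom k).1 := rfl
    rw [h1, h2, K.map_comp, x.map_comp]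
    simp only [NatTrans.comp_app, Functor.map_comp, Category.assoc, NatTrans.naturality_assoc]

theorem nerveChain_prismFunctor_face (K : Fin 2 ⥤ C ⥤ D) {n : ℕ} (x : (nerve C) _⦋n⦌)
    (ε : Fin 2) :
    nerveChain (prismFunctor K x) (Prism.face n ε) = (nerveMap (K.obj ε)).app _ x := by
  refine CategoryTheory.Functor.ext (fun _ => rfl) fun i j h => ?_
  have h1 : (K.map (homOfLE (le_refl ε))).app (x.obj i) = 𝟙 _ := by
    have : homOfLE (le_refl ε) = 𝟙 ε := rfl
    rw [this]
    simp
  have h2 : (nerveChain (prismFunctor K x) (Prism.face n ε)).map h =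
      (K.map (homOfLE (le_refl ε))).app (x.obj i) ≫ (K.obj ε).map (x.map h) := rfl
  rw [h2, h1, Category.id_comp]
  exact ((Category.id_comp _).trans (Category.comp_id _)).symm

/-- The realization of the prism over a simplex of the nerve of `C`. -/
noncomputable def prismMap (K : Fin 2 ⥤ C ⥤ D) {n : ℕ} (x : (nerve C) _⦋n⦌) :
    C(stdSimplex ℝ (Fin (n + 1)) × unitInterval, nerveRealization D) :=
  ⟨fun z => Prism.realizationFun (prismFunctor K x) (z.2, z.1),
    (Prism.continuous_realizationFun _).comp continuous_swap⟩

/-- A maximal chain of the smaller prism, pushed along `Prism.mapHom`, is a chain of the larger one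
carrying the right weights by `Prism.map_weight`. The two simplices of the nerve agree by
definition. -/
theorem prismMap_map (K : Fin 2 ⥤ C ⥤ D) {m n : ℕ} (f : ⦋m⦌ ⟶ ⦋n⦌) (x : (nerve C) _⦋n⦌)
    (t : stdSimplex ℝ (Fin (m + 1))) (s : unitInterval) :
    prismMap K ((nerve C).map f.op x) (t, s) = prismMap K x (stdSimplex.map f t, s) := by
  let f' : Fin (m + 1) →o Fin (n + 1) := f.toOrderHom
  obtain ⟨k, hk⟩ := Prism.exists_mem_region (s, t)
  have h0 := stdSimplex.map_comap _ (Prism.chain_injective k) _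
      (Prism.mem_range_chain_of_mem_region hk)
  have h1 := Prism.charMap_eq_realizationFun (prismFunctor K ((nerve C).map f.op x)) (s, t)
    (Prism.chain k) _ h0
  have h2 := Prism.charMap_eq_realizationFun (prismFunctor K x) (s, stdSimplex.map f t)
    ((Prism.mapHom f').comp (Prism.chain k)) (stdSimplex.comap _ (Prism.chain_injective k) _
      (Prism.mem_range_chain_of_mem_region hk)) (by
        refine Eq.trans ?_ (Prism.map_weight f' s t)
        refine Eq.trans ?_ (congrArg (stdSimplex.map (Prism.mapHom f')) h0)
        rw [stdSimplex.map_comp_apply]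
        rfl)
  exact h1.symm.trans h2

theorem prismMap_zero (K : Fin 2 ⥤ C ⥤ D) {n : ℕ} (x : (nerve C) _⦋n⦌)
    (t : stdSimplex ℝ (Fin (n + 1))) :
    prismMap K x (t, 0) = (nerve D).charMap ((nerveMap (K.obj 1)).app _ x) t := by
  rw [← nerveChain_prismFunctor_face]
  exact (Prism.charMap_eq_realizationFun _ (0, t) _ _ (Prism.map_face_one t)).symm

theorem prismMap_one (K : Fin 2 ⥤ C ⥤ D) {n : ℕ} (x : (nerve C) _⦋n⦌)
    (t : stdSimplex ℝ (Fin (n + 1))) :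
    prismMap K x (t, 1) = (nerve D).charMap ((nerveMap (K.obj 0)).app _ x) t := by
  rw [← nerveChain_prismFunctor_face]
  exact (Prism.charMap_eq_realizationFun _ (1, t) _ _ (Prism.map_face_zero t)).symm

/-- The homotopy on realizations of nerves, as a map to a space of paths. -/
noncomputable def nerveHomotopyMap (K : Fin 2 ⥤ C ⥤ D) :
    nerveRealization C ⟶ TopCat.of C(unitInterval, nerveRealization D) :=
  -- Currying time into the target leaves a map out of a realization, which can be defined simplex
  -- by simplex.
  SSet.toTopDesc (fun _ x => (prismMap K x).curry) fun _ _ f x t => by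
    ext s
    exact prismMap_map K f x t s

theorem nerveHomotopyMap_charMap (K : Fin 2 ⥤ C ⥤ D) {n : ℕ} (x : (nerve C) _⦋n⦌)
    (t : stdSimplex ℝ (Fin (n + 1))) (s : unitInterval) :
    (nerveHomotopyMap K ((nerve C).charMap x t) : C(unitInterval, nerveRealization D)) s =
      prismMap K x (t, s) := by
  have h := SSet.toTopDesc_charMap (Z := TopCat.of C(unitInterval, nerveRealization D))
    (fun _ x => (prismMap K x).curry) (fun _ _ f x t => ContinuousMap.ext fun s =>
      prismMap_map K f x t s) x t
  exact DFunLike.congr_fun (F := C(unitInterval, nerveRealization D)) h s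

/-- The value of the homotopy at a given time. -/
noncomputable def nerveHomotopyAt (K : Fin 2 ⥤ C ⥤ D) (s : unitInterval) :
    nerveRealization C ⟶ nerveRealization D :=
  nerveHomotopyMap K ≫ TopCat.ofHom ⟨fun c : C(unitInterval, nerveRealization D) => c s,
    ContinuousEvalConst.continuous_eval_const s⟩

theorem nerveHomotopyAt_zero (K : Fin 2 ⥤ C ⥤ D) :
    nerveHomotopyAt K 0 = SSet.toTop.map (nerveMap (K.obj 1)) :=
  SSet.toTop_hom_ext fun _ x t => (nerveHomotopyMap_charMap K x t 0).trans
    ((prismMap_zero K x t).trans (SSet.toTop_map_charMap _ x t).symm)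

theorem nerveHomotopyAt_one (K : Fin 2 ⥤ C ⥤ D) :
    nerveHomotopyAt K 1 = SSet.toTop.map (nerveMap (K.obj 0)) :=
  SSet.toTop_hom_ext fun _ x t => (nerveHomotopyMap_charMap K x t 1).trans
    ((prismMap_one K x t).trans (SSet.toTop_map_charMap _ x t).symm)

/-- A natural transformation induces a homotopy on realizations of nerves. -/
theorem homotopic_of_natTrans {F G : C ⥤ D} (η : F ⟶ G) :
    ContinuousMap.Homotopic (SSet.toTop.map (nerveMap F)).hom
      (SSet.toTop.map (nerveMap G)).hom := by
  let K := ComposableArrows.mk₁ η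
  -- Time `0` is the target functor `K.obj 1`, hence the reversal.
  refine ContinuousMap.Homotopic.symm ⟨⟨⟨fun z => nerveHomotopyAt K z.1 z.2, ?_⟩, ?_, ?_⟩⟩
  · exact (continuous_eval (X := unitInterval) (Y := nerveRealization D)).comp
      (((nerveHomotopyMap K).hom.continuous.comp continuous_snd).prodMk continuous_fst)
  · intro x
    exact congrArg (fun k => k x) (nerveHomotopyAt_zero K)
  · intro x
    exact congrArg (fun k => k x) (nerveHomotopyAt_one K)

/-- A constant functor sends every simplex to a degeneracy of the vertex `d`, so its realization is
a constant map. -/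
theorem nerveMap_const_nullhomotopic (d : D) :
    ((SSet.toTop.map (nerveMap ((Functor.const C).obj d))).hom).Nullhomotopic := by
  let y : (nerve D) _⦋0⦌ := ComposableArrows.mk₀ d
  let t₀ : stdSimplex ℝ (Fin (0 + 1)) := default
  let p : nerveRealization D := (nerve D).charMap y t₀
  have h : SSet.toTop.map (nerveMap ((Functor.const C).obj d)) =
      TopCat.ofHom (ContinuousMap.const _ p) := SSet.toTop_hom_ext fun n x t => by
    refine (SSet.toTop_map_charMap _ x t).trans ?_
    let f : ⦋n⦌ ⟶ ⦋0⦌ := SimplexCategory.mkHom ⟨fun _ => 0, fun _ _ _ => le_rfl⟩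
    have h1 : (nerveMap ((Functor.const C).obj d)).app _ x = (nerve D).map f.op y :=
      CategoryTheory.Functor.ext (fun _ => rfl) fun i j k => by
        exact ((Category.id_comp _).trans (Category.comp_id _)).symm
    rw [h1, SSet.charMap_map]
    exact congrArg ((nerve D).charMap y) (Subsingleton.elim (α := stdSimplex ℝ (Fin (0 + 1))) _ _)
  rw [h]
  exact ContinuousMap.nullhomotopic_of_constant p

/-- A category with an endofunctor that receives natural transformations from the identity and
from a constant functor has a contractible nerve. -/
theorem contractibleSpace_nerveRealization (T : C ⥤ C) (η : 𝟭 C ⟶ T) (c : C)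
    (θ : (Functor.const C).obj c ⟶ T) : ContractibleSpace (nerveRealization C) := by
  rw [contractible_iff_id_nullhomotopic]
  have h1 : (SSet.toTop.map (nerveMap (𝟭 C))).hom = ContinuousMap.id _ := by
    have : nerveMap (𝟭 C) = 𝟙 (nerve C) := rfl
    rw [this, CategoryTheory.Functor.map_id]
    rfl
  obtain ⟨p, hp⟩ := nerveMap_const_nullhomotopic (C := C) c
  refine ⟨p, ?_⟩
  rw [← h1]
  exact ((homotopic_of_natTrans η).trans (homotopic_of_natTrans θ).symm).trans hp

end NaturalTransformation

/-! ### Extensions of automorphisms -/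

section AutExtension

variable {S : Type u} [Group S] {P : Subgroup S}

theorem mem_normalizer_of_conj {β : MulAut P} {z : S} (h : ∀ g : P, z * g * z⁻¹ = β g) :
    z ∈ Subgroup.normalizer (P : Set S) := by
  rw [Subgroup.mem_normalizer_iff]
  intro x
  refine ⟨fun hx => (h ⟨x, hx⟩).symm ▸ (β ⟨x, hx⟩).2, fun hx => ?_⟩
  obtain ⟨g, hg⟩ := β.surjective ⟨_, hx⟩
  have h1 : z * g * z⁻¹ = z * x * z⁻¹ := by rw [h, hg]
  have h2 : (g : S) = x := mul_left_cancel (mul_right_cancel h1)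
  exact h2 ▸ g.2

theorem mem_autS_of_conj {β : MulAut P} {z : S} (h : ∀ g : P, z * g * z⁻¹ = β g) :
    β ∈ autS P :=
  ⟨⟨z, mem_normalizer_of_conj h⟩, by ext g; exact h g⟩

theorem innerAut_le_autS (P : Subgroup S) : innerAut P ≤ autS P := by
  rintro _ ⟨x, rfl⟩
  exact mem_autS_of_conj (z := x) fun g => rfl

/-- The witness `z` need not be assumed to normalize `P`: it acts on `P` as the bijection `α c_y
α⁻¹`. -/
theorem mem_autExtensionGroup_iff {α : MulAut P} {y : S} :
    y ∈ autExtensionGroup P α ↔ y ∈ Subgroup.normalizer (P : Set S) ∧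
      ∃ z : S, ∀ g h : P, y * g * y⁻¹ = h → z * α g * z⁻¹ = α h := by
  rw [mem_autExtensionGroup]
  refine ⟨?_, ?_⟩
  · rintro ⟨hy, z, hz⟩
    refine ⟨hy, z, fun g h hgh => ?_⟩
    have h1 := congrArg Subtype.val (DFunLike.congr_fun hz (α g))
    refine h1.trans ?_
    simp only [MulAut.mul_apply, MulAut.inv_apply_self]
    congr 2
    exact Subtype.ext hgh
  · rintro ⟨hy, z, hz⟩
    refine ⟨hy, mem_autS_of_conj (z := z) fun g => ?_⟩
    have h1 := hz (α⁻¹ g) (P.normalizerMonoidHom ⟨y, hy⟩ (α⁻¹ g)) rfl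
    rwa [MulAut.apply_inv_self] at h1

namespace FusionSystem

variable {F : FusionSystem S}

/-- `φ` is an isomorphism of `F` onto its image, followed by an inclusion that can be replaced. -/
theorem exists_corestrict {A B C : Subgroup S} {φ : A →* B} (hφ : φ ∈ F.Hom A B)
    (h : ∀ x, (φ x : S) ∈ C) : ∃ ψ ∈ F.Hom A C, ∀ x, (ψ x : S) = φ x := by
  obtain ⟨R, hR, e, he, -, rfl⟩ := F.factor hφ
  have hRC : R ≤ C := fun y hy => by
    obtain ⟨x, hx⟩ := e.surjective ⟨y, hy⟩
    have h1 := h x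
    rwa [show (((Subgroup.inclusion hR).comp e.toMonoidHom) x : S) = y from
      congrArg Subtype.val hx] at h1
  exact ⟨_, F.comp_mem he (F.inclusion_mem hRC), fun x => rfl⟩

/-- If `c_z = α c_y α⁻¹` on `P`, then `β c_z β⁻¹ = (βα) c_y (βα)⁻¹`, and `y` lies in `N_{βα}`. -/
theorem mem_tilde_of_conj {α : MulAut P} (hα : α ∈ F.aut P) {y z : S} (hy : y ∈ F.tilde P)
    (h : ∀ g h : P, y * g * y⁻¹ = h → z * α g * z⁻¹ = α h) : z ∈ F.tilde P := by
  have hy' := hy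
  simp only [tilde, Subgroup.mem_iInf] at hy' ⊢
  have hyN := F.tilde_le_normalizer P hy
  have hconj : ∀ g : P, z * g * z⁻¹ = α (P.normalizerMonoidHom ⟨y, hyN⟩ (α⁻¹ g)) := fun g => by
    have h1 := h (α⁻¹ g) (P.normalizerMonoidHom ⟨y, hyN⟩ (α⁻¹ g)) rfl
    rwa [MulAut.apply_inv_self] at h1
  have hzN : z ∈ Subgroup.normalizer (P : Set S) := mem_normalizer_of_conj
    (β := α * P.normalizerMonoidHom ⟨y, hyN⟩ * α⁻¹) hconj
  intro β hβ
  obtain ⟨-, w, hw⟩ := mem_autExtensionGroup_iff.1 (hy' (β * α) (mul_mem hβ hα))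
  refine mem_autExtensionGroup_iff.2 ⟨hzN, w, fun g k hgk => ?_⟩
  have h1 := hw (α⁻¹ g) (P.normalizerMonoidHom ⟨y, hyN⟩ (α⁻¹ g)) rfl
  rw [MulAut.mul_apply, MulAut.mul_apply, MulAut.apply_inv_self] at h1
  rw [h1]
  congr 2
  exact Subtype.ext ((hconj g).symm.trans hgk)

/-- Viewed as a map to `S`, `α` has image `P`, which is fully centralized, so the extension axiom
applies. -/
theorem IsSaturated.exists_extend {p : ℕ} (hF : F.IsSaturated p) (hn : F.IsFullyNormalized p P)
    {α : MulAut P} (hα : α ∈ F.aut P) {Q : Subgroup S} (hPQ : P ≤ Q)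
    (hQ : Q ≤ autExtensionGroup P α) :
    ∃ ψ ∈ F.Hom Q ⊤, homRestrict ψ hPQ = (Subgroup.inclusion le_top).comp α.toMonoidHom := by
  let φ : P →* (⊤ : Subgroup S) := (Subgroup.inclusion le_top).comp α.toMonoidHom
  have hφ : φ ∈ F.Hom P ⊤ := F.comp_mem hα.1 (F.inclusion_mem le_top)
  have him : homImage φ = P := by
    apply le_antisymm
    · rintro _ ⟨_, ⟨x, rfl⟩, rfl⟩
      exact (α x).2
    · intro y hy
      obtain ⟨x, hx⟩ := α.surjective ⟨y, hy⟩
      exact ⟨_, ⟨x, rfl⟩, congrArg Subtype.val hx⟩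
  obtain ⟨ψ, hψ, h, hψφ⟩ := hF.extend P φ hφ (him.symm ▸ (hF.sylow P hn).1)
  have hle : Q ≤ homExtensionGroup φ := fun y hy => by
    obtain ⟨hyN, z, hz⟩ := mem_autExtensionGroup.1 (hQ hy)
    refine ⟨⟨y, hyN⟩, ⟨(homImage φ).normalizerMonoidHom ⟨z, him.symm ▸ z.2⟩, ⟨_, rfl⟩,
      fun x => ?_⟩, rfl⟩
    have h1 := congrArg Subtype.val (DFunLike.congr_fun hz (α x))
    simp only [MulAut.mul_apply, MulAut.inv_apply_self] at h1
    exact h1.symm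
  exact ⟨ψ.comp (Subgroup.inclusion hle), F.comp_mem (F.inclusion_mem hle) hψ, hψφ⟩

theorem IsSaturated.isGreatest_tilde {p : ℕ} (hF : F.IsSaturated p)
    (hn : F.IsFullyNormalized p P) :
    IsGreatest {Q : Subgroup S | Q ≤ Subgroup.normalizer (P : Set S) ∧
        ∃ h : P ≤ Q, ∀ α ∈ F.aut P, ∃ ψ ∈ F.Hom Q ⊤,
          homRestrict ψ h = (Subgroup.inclusion le_top).comp α.toMonoidHom} (F.tilde P) := by
  refine ⟨⟨F.tilde_le_normalizer P, F.le_tilde P, fun α hα =>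
    hF.exists_extend hn hα _ (iInf₂_le α hα)⟩, ?_⟩
  rintro Q ⟨hQN, hPQ, hQ⟩ y hy
  simp only [tilde, Subgroup.mem_iInf]
  intro α hα
  obtain ⟨ψ, -, hψ⟩ := hQ α hα
  have h1 : ∀ g : P, (ψ (Subgroup.inclusion hPQ g) : S) = α g := fun g =>
    congrArg Subtype.val (DFunLike.congr_fun hψ g)
  -- The extension supplies the witness: conjugation by `ψ(y)` is `α c_y α⁻¹` on `P`.
  refine mem_autExtensionGroup_iff.2 ⟨hQN hy, ψ ⟨y, hy⟩, fun g k hgk => ?_⟩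
  rw [← h1, ← h1]
  have h2 : Subgroup.inclusion hPQ k = ⟨y, hy⟩ * Subgroup.inclusion hPQ g * ⟨y, hy⟩⁻¹ :=
    Subtype.ext hgk.symm
  rw [h2, map_mul, map_mul, map_inv]
  rfl

theorem IsSaturated.lt_tilde {p : ℕ} [Fact p.Prime] (hF : F.IsSaturated p)
    (hn : F.IsFullyNormalized p P) (hr : ¬ F.IsRadical p P) : P < F.tilde P := by
  obtain ⟨-, hfin, T, hT⟩ := hF.sylow P hn
  simp only [IsRadical, not_forall] at hr
  obtain ⟨N, hN, hNp, hN1⟩ := hr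
  -- A normal `p`-subgroup lies in every Sylow subgroup; `y` below induces a nontrivial class of
  -- `N`.
  have hNT : N ≤ F.outS P := hT ▸ hNp.le_sylow_of_normal T
  obtain ⟨n, hnN, hn1⟩ := N.bot_or_exists_ne_one.resolve_left hN1
  obtain ⟨a, ha, han⟩ := hNT hnN
  obtain ⟨y, hy⟩ : (a : MulAut P) ∈ autS P := ha
  refine SetLike.lt_iff_le_and_exists.2 ⟨F.le_tilde P, (y : S), ?_, fun hyP => hn1 ?_⟩
  · simp only [tilde, Subgroup.mem_iInf]
    intro α hα
    refine mem_autExtensionGroup.2 ⟨y.2, ?_⟩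
    have h1 : (QuotientGroup.mk' _ (⟨α, hα⟩ * a * ⟨α, hα⟩⁻¹) : F.Out P) ∈ F.outS P := by
      refine hNT ?_
      rw [map_mul, map_mul, map_inv, han]
      exact hN.conj_mem _ hnN _
    obtain ⟨b, hb, hbe⟩ := h1
    -- The conjugate agrees with `b ∈ Aut_S(P)` up to an inner automorphism, which is itself in
    -- `Aut_S(P)`.
    have h2 := QuotientGroup.eq.1 hbe
    have h3 : ((b⁻¹ * (⟨α, hα⟩ * a * ⟨α, hα⟩⁻¹) : F.aut P) : MulAut P) ∈ autS P :=
      innerAut_le_autS P h2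
    have h4 := mul_mem (show (b : MulAut P) ∈ autS P from hb) h3
    have h5 : (b : MulAut P) * ((b⁻¹ * (⟨α, hα⟩ * a * ⟨α, hα⟩⁻¹) : F.aut P) : MulAut P) =
        α * P.normalizerMonoidHom y * α⁻¹ := by
      rw [hy]
      simp
    rwa [h5] at h4
  · rw [← han]
    refine (QuotientGroup.eq_one_iff a).2 ?_
    refine ⟨⟨y, hyP⟩, ?_⟩
    refine Eq.trans ?_ hy
    ext x
    rfl

end FusionSystem

end AutExtension

/-! ### Morphisms of linking systems -/

namespace FusionSystem.CentricLinkingSystem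

variable {S : Type u} [Group S] {F : FusionSystem S} (L : F.CentricLinkingSystem)

/-- The distinguished monomorphism `δ_X`, on the objects of `L`. -/
def distHom (X : L.Obj) : X.toSubgroup →* Aut X := L.dist X

/-- The endomorphism `δ_X(g)` of the object `X`. -/
def delta (X : L.Obj) (g : X.toSubgroup) : X ⟶ X := (L.distHom X g).hom

theorem delta_one (X : L.Obj) : L.delta X 1 = 𝟙 X := by
  rw [delta, map_one]
  rfl

theorem delta_mul (X : L.Obj) (g h : X.toSubgroup) :
    L.delta X (g * h) = L.delta X h ≫ L.delta X g := by
  rw [delta, map_mul]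
  rfl

variable {L} {X Y Z : L.Obj}

theorem map_delta (g x : X.toSubgroup) : L.map (L.delta X g) x = g * x * g⁻¹ :=
  DFunLike.congr_fun (L.proj_dist X g) x

theorem comp_delta (f : X ⟶ Y) (g : X.toSubgroup) :
    f ≫ L.delta Y (L.map f g) = L.delta X g ≫ f :=
  L.comm f g

theorem map_eq_iff (f g : X ⟶ Y) :
    L.map f = L.map g ↔ ∃ z ∈ Subgroup.center X.toSubgroup, g = L.delta X z ≫ f :=
  L.proj_eq_iff f g

theorem eq_one_of_delta_comp {f : X ⟶ Y} {z : X.toSubgroup}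
    (hz : z ∈ Subgroup.center X.toSubgroup) (h : L.delta X z ≫ f = f) : z = 1 :=
  L.free f z hz h

theorem map_mem (f : X ⟶ Y) : L.map f ∈ F.Hom X.toSubgroup Y.toSubgroup :=
  (L.range_proj X Y).subset ⟨f, rfl⟩

theorem exists_map_eq {φ : X.toSubgroup →* Y.toSubgroup}
    (hφ : φ ∈ F.Hom X.toSubgroup Y.toSubgroup) : ∃ f : X ⟶ Y, L.map f = φ :=
  (L.range_proj X Y).superset hφ

theorem map_injective (f : X ⟶ Y) : Function.Injective (L.map f) := F.injective (map_mem f)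

theorem map_comp_apply (f : X ⟶ Y) (g : Y ⟶ Z) (x : X.toSubgroup) :
    L.map (f ≫ g) x = L.map g (L.map f x) :=
  DFunLike.congr_fun (L.map_comp f g) x

/-- The morphisms of a centric linking system are monomorphisms. -/
theorem mono_hom (g : Y ⟶ Z) : Mono g := by
  refine ⟨fun {X} h k hhk => ?_⟩
  have h1 : L.map h = L.map k := MonoidHom.ext fun x => map_injective g (by
    rw [← map_comp_apply, ← map_comp_apply, hhk])
  obtain ⟨z, hz, rfl⟩ := (map_eq_iff h k).1 h1
  rw [Category.assoc] at hhk
  rw [eq_one_of_delta_comp hz hhk.symm, delta_one, Category.id_comp]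

/-- Freeness on the target side: `c` centralizes the image of `f`, a conjugate of the centric `X`,
so `c` is the image of a central `z` of `X`. Moving `δ(c)` across `f` reduces to freeness at the
source. -/
theorem eq_one_of_comp_delta {f : X ⟶ Y} {c : Y.toSubgroup} (h : f ≫ L.delta Y c = f) :
    c = 1 := by
  have hc : ∀ x, c * L.map f x * c⁻¹ = L.map f x := fun x => by
    rw [← map_delta, ← map_comp_apply, h]
  obtain ⟨R, hR, e, he, he', hfe⟩ := F.factor (map_mem f)
  have hf : ∀ x, (L.map f x : S) = e x := fun x => congrArg Subtype.val (DFunLike.congr_fun hfe x)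
  have hcR : (c : S) ∈ R := by
    refine CentricSubgroup.isCentric X R ⟨e, he, he'⟩ ?_
    rw [Subgroup.mem_centralizer_iff]
    intro y hy
    obtain ⟨x, hx⟩ := e.surjective ⟨y, hy⟩
    have h1 := congrArg Subtype.val (hc x)
    have h2 : (L.map f x : S) = y := (hf x).trans (congrArg Subtype.val hx)
    simp only [Subgroup.coe_mul, Subgroup.coe_inv, h2] at h1
    rw [← mul_inv_eq_iff_eq_mul.1 h1]
  obtain ⟨z, hz⟩ := e.surjective ⟨c, hcR⟩
  have hzc : L.map f z = c := Subtype.ext ((hf z).trans (congrArg Subtype.val hz))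
  have hz1 : z ∈ Subgroup.center X.toSubgroup := by
    rw [Subgroup.mem_center_iff]
    intro x
    apply map_injective f
    rw [map_mul, map_mul, hzc]
    exact (mul_inv_eq_iff_eq_mul.1 (hc x)).symm
  rw [← hzc, comp_delta] at h
  rw [← hzc, eq_one_of_delta_comp hz1 h, map_one]

/-- Conjugation by `x` preserves the image of `k`, so it transports to `X` and lifts to `L`; a
central `δ(z)` corrects the lift. -/
theorem exists_comp_eq_comp_delta (k : X ⟶ Y) (x : Y.toSubgroup)
    (h : ∀ u, ∃ u', L.map k u' = x * L.map k u * x⁻¹) : ∃ u : X ⟶ X, u ≫ k = k ≫ L.delta Y x := by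
  obtain ⟨R, hR, e, he, he', hke⟩ := F.factor (map_mem k)
  have hk : ∀ x, (L.map k x : S) = e x := fun x => congrArg Subtype.val (DFunLike.congr_fun hke x)
  have hx : ∀ y ∈ R, (x : S) * y * (x : S)⁻¹ ∈ R := fun y hy => by
    obtain ⟨u, hu⟩ := e.surjective ⟨y, hy⟩
    obtain ⟨u', hu'⟩ := h u
    have h1 := congrArg Subtype.val hu'
    simp only [Subgroup.coe_mul, Subgroup.coe_inv, hk, hu] at h1
    rw [← h1]
    exact (e u').2
  obtain ⟨u, hu⟩ := exists_map_eq (L := L) (F.comp_mem (F.comp_mem he (F.conj_mem (x : S) hx)) he')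
  have h1 : L.map (u ≫ k) = L.map (k ≫ L.delta Y x) := by
    ext y
    rw [map_comp_apply, map_comp_apply, map_delta, hk, hu]
    simp only [Subgroup.coe_mul, Subgroup.coe_inv, hk]
    exact congrArg Subtype.val (e.apply_symm_apply (conjHom (x : S) hx (e y)))
  obtain ⟨z, -, hz⟩ := (map_eq_iff _ _).1 h1
  exact ⟨L.delta X z ≫ u, by rw [Category.assoc, ← hz]⟩

/-- A morphism whose image is normal is an epimorphism. -/
theorem epi_of_normal (k : X ⟶ Y)
    (hk : ∀ x u, ∃ u', L.map k u' = x * L.map k u * x⁻¹) : Epi k := by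
  refine ⟨fun {Z} h₁ h₂ h => ?_⟩
  -- With `u ≫ k = k ≫ δ(x)`, the composite `u ≫ k ≫ hᵢ` equals `(k ≫ hᵢ) ≫ δ(π(hᵢ)(x))`. Since `k ≫
  -- h₁ = k ≫ h₂`, freeness on the target side identifies the two values at `x`.
  have h1 : L.map h₁ = L.map h₂ := MonoidHom.ext fun x => by
    obtain ⟨u, hu⟩ := exists_comp_eq_comp_delta k x (hk x)
    have e1 : u ≫ k ≫ h₁ = (k ≫ h₁) ≫ L.delta Z (L.map h₁ x) := by
      rw [← Category.assoc, hu, Category.assoc, Category.assoc, comp_delta]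
    have e2 : u ≫ k ≫ h₂ = (k ≫ h₂) ≫ L.delta Z (L.map h₂ x) := by
      rw [← Category.assoc, hu, Category.assoc, Category.assoc, comp_delta]
    rw [← h, e1] at e2
    have e3 : (k ≫ h₁) ≫ L.delta Z ((L.map h₁ x)⁻¹ * L.map h₂ x) = k ≫ h₁ := by
      rw [delta_mul, ← Category.assoc, ← e2, Category.assoc, ← delta_mul, inv_mul_cancel, delta_one,
        Category.comp_id]
    exact (inv_mul_eq_one.1 (eq_one_of_comp_delta e3))
  obtain ⟨w, -, rfl⟩ := (map_eq_iff h₁ h₂).1 h1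
  have := mono_hom h₁
  rw [← Category.assoc, cancel_mono] at h
  rw [eq_one_of_comp_delta h.symm, delta_one, Category.id_comp]

end FusionSystem.CentricLinkingSystem

/-! ### The undercategory of `P` in its normalizer -/

section RelativeExtension

variable {S : Type u} [Group S] {P : Subgroup S}

/-- For `α ∈ Aut(P)`, the group of those `x ∈ N_S(P)` such that `α c_x α⁻¹` is conjugation by an
element of `R`. -/
def relExtensionGroup (α : MulAut P) (R : Subgroup S) : Subgroup S where
  carrier := {x | x ∈ Subgroup.normalizer (P : Set S) ∧
    ∃ y ∈ R, ∀ g h : P, x * g * x⁻¹ = h → y * α g * y⁻¹ = α h}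
  one_mem' := ⟨one_mem _, 1, one_mem _, fun g h hgh => by
    have : g = h := Subtype.ext (by simpa using hgh)
    simp [this]⟩
  mul_mem' := by
    rintro x₁ x₂ ⟨hx₁, y₁, hy₁, h₁⟩ ⟨hx₂, y₂, hy₂, h₂⟩
    refine ⟨mul_mem hx₁ hx₂, y₁ * y₂, mul_mem hy₁ hy₂, fun g h hgh => ?_⟩
    have h3 := h₂ g ⟨x₂ * g * x₂⁻¹, (Subgroup.mem_normalizer_iff.1 hx₂ _).1 g.2⟩ rfl
    rw [← h₁ ⟨x₂ * g * x₂⁻¹, (Subgroup.mem_normalizer_iff.1 hx₂ _).1 g.2⟩ h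
      (by rw [← hgh]; group), ← h3]
    group
  inv_mem' := by
    rintro x ⟨hx, y, hy, h⟩
    refine ⟨inv_mem hx, y⁻¹, inv_mem hy, fun g k hgk => ?_⟩
    rw [← h k g (by rw [← hgk]; group)]
    group

theorem relExtensionGroup_le (α : MulAut P) (R : Subgroup S) :
    relExtensionGroup α R ≤ autExtensionGroup P α := by
  rintro x ⟨hx, y, -, h⟩
  exact mem_autExtensionGroup_iff.2 ⟨hx, y, h⟩

theorem le_relExtensionGroup (α : MulAut P) {R : Subgroup S} (hR : P ≤ R) :
    P ≤ relExtensionGroup α R := by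
  intro x hx
  refine ⟨Subgroup.le_normalizer hx, α ⟨x, hx⟩, hR (α ⟨x, hx⟩).2, fun g h hgh => ?_⟩
  have : h = ⟨x, hx⟩ * g * ⟨x, hx⟩⁻¹ := Subtype.ext hgh.symm
  rw [this, map_mul, map_mul, map_inv]
  rfl

/-- The element inducing `α c_x α⁻¹` is again in `P̃`, hence in `R`. -/
theorem FusionSystem.tilde_le_relExtensionGroup {F : FusionSystem S} {α : MulAut P}
    (hα : α ∈ F.aut P) {R : Subgroup S} (hR : F.tilde P ≤ R) :
    F.tilde P ≤ relExtensionGroup α R := by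
  intro x hx
  have hx' := hx
  simp only [FusionSystem.tilde, Subgroup.mem_iInf] at hx'
  obtain ⟨hxN, z, hz⟩ := mem_autExtensionGroup_iff.1 (hx' α hα)
  exact ⟨hxN, z, hR (FusionSystem.mem_tilde_of_conj hα hx hz), hz⟩

theorem FusionSystem.exists_aut_of_homImage_eq {F : FusionSystem S} {A B : Subgroup S}
    {φ : A →* B} (hφ : φ ∈ F.Hom A B) (h : P ≤ A) (him : homImage (homRestrict φ h) = P) :
    ∃ α ∈ F.aut P, ∀ g : P, (α g : S) = φ ⟨g, h g.2⟩ := by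
  obtain ⟨R, hR, e, he, he', hφe⟩ := F.factor (F.comp_mem (F.inclusion_mem h) hφ)
  have hRP : R = P := by
    rw [← him]
    apply le_antisymm
    · intro y hy
      obtain ⟨x, hx⟩ := e.surjective ⟨y, hy⟩
      refine ⟨_, ⟨x, rfl⟩, ?_⟩
      exact (congrArg Subtype.val (DFunLike.congr_fun hφe x)).trans (congrArg Subtype.val hx)
    · rintro _ ⟨_, ⟨x, rfl⟩, rfl⟩
      have h1 := congrArg Subtype.val (DFunLike.congr_fun hφe x)
      exact Set.mem_of_eq_of_mem h1 (e x).2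
  subst hRP
  exact ⟨e, ⟨he, he'⟩, fun g => (congrArg Subtype.val (DFunLike.congr_fun hφe g)).symm⟩

end RelativeExtension

namespace FusionSystem.CentricLinkingSystem

variable {S : Type u} [Group S] {F : FusionSystem S} {L : F.CentricLinkingSystem}
  {P : Subgroup S} {hc : F.IsCentric P} {Q R T : L.NormalizerObj hc}

namespace NormalizerObj

/-- The homomorphism `π(f)`, for a morphism `f` of `N_L(P)`. -/
def Hom.toFun (f : Q ⟶ R) : (Q.toSubgroup ⊔ P : Subgroup S) →* (R.toSubgroup ⊔ P : Subgroup S) :=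
  L.map f.hom

theorem Hom.toFun_comp (f : Q ⟶ R) (g : R ⟶ T) (x : (Q.toSubgroup ⊔ P : Subgroup S)) :
    Hom.toFun (f ≫ g) x = Hom.toFun g (Hom.toFun f x) :=
  map_comp_apply f.hom g.hom x

theorem Hom.toFun_mem (f : Q ⟶ R) (x : (Q.toSubgroup ⊔ P : Subgroup S))
    (hx : (x : S) ∈ Q.toSubgroup) : (Hom.toFun f x : S) ∈ R.toSubgroup := by
  obtain ⟨ψ, -, h⟩ := f.restrict_mem
  have h1 := congrArg Subtype.val (DFunLike.congr_fun h ⟨x, hx⟩)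
  exact Set.mem_of_eq_of_mem h1 (ψ ⟨x, hx⟩).2

theorem Hom.exists_aut (f : Q ⟶ R) :
    ∃ α ∈ F.aut P, ∀ g : P, (α g : S) = Hom.toFun f ⟨g, le_sup_right (a := Q.toSubgroup) g.2⟩ :=
  exists_aut_of_homImage_eq (map_mem f.hom) le_sup_right f.image_eq

theorem sup_le_normalizer (Q : L.NormalizerObj hc) :
    Q.toSubgroup ⊔ P ≤ Subgroup.normalizer (P : Set S) :=
  sup_le Q.le_normalizer Subgroup.le_normalizer

/-- The morphisms under `P` in `N_L(P)` are unique. -/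
theorem eq_of_comp_eq (a : L.normalizerBase hc ⟶ Q) {f g : Q ⟶ R} (h : a ≫ f = a ≫ g) :
    f = g := by
  -- The image of `a` is `P`, which is normal in `Q P ≤ N_S(P)`. The source of `a.hom` is literally
  -- `P ⊔ P`.
  have : Epi a.hom := by
    refine epi_of_normal a.hom fun x u => ?_
    obtain ⟨α, -, hα⟩ := Hom.exists_aut a
    obtain ⟨u, hu⟩ := u
    have huP : u ∈ P := (sup_le le_rfl le_rfl : P ⊔ P ≤ P) hu
    have h1 := (Subgroup.mem_normalizer_iff.1 (Q.sup_le_normalizer x.2) _).1 (α ⟨u, huP⟩).2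
    obtain ⟨v, hv⟩ := α.surjective ⟨_, h1⟩
    refine ⟨⟨v, (le_sup_left : P ≤ P ⊔ P) v.2⟩, Subtype.ext ?_⟩
    refine (hα v).symm.trans ((congrArg Subtype.val hv).trans ?_)
    exact congrArg (fun y => (x : S) * y * (x : S)⁻¹) (hα ⟨u, huP⟩)
  refine NormalizerObj.Hom.ext ((cancel_epi a.hom).1 ?_)
  exact congrArg NormalizerObj.Hom.hom h

/-- Morphisms between objects under `P` exist when the conjugation actions on `P` are
compatible. -/
theorem exists_comp_eq {p : ℕ} (hF : F.IsSaturated p) (hn : F.IsFullyNormalized p P)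
    (a : L.normalizerBase hc ⟶ Q) (b : L.normalizerBase hc ⟶ R) (hPR : P ≤ R.toSubgroup)
    {α : MulAut P} (hα : α ∈ F.aut P)
    (hab : ∀ (g : (P ⊔ P : Subgroup S)) (g' : P), (Hom.toFun a g : S) = g' →
      (α g' : S) = Hom.toFun b g)
    (hQ : Q.toSubgroup ≤ relExtensionGroup α R.toSubgroup) : ∃ f : Q ⟶ R, a ≫ f = b := by
  have hQP : Q.toSubgroup ⊔ P ≤ relExtensionGroup α R.toSubgroup :=
    sup_le hQ (le_relExtensionGroup α hPR)
  obtain ⟨ψ, hψ, hψα⟩ := hF.exists_extend hn hα (le_sup_right : P ≤ Q.toSubgroup ⊔ P)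
    (hQP.trans (relExtensionGroup_le _ _))
  have hψα' : ∀ g : P, (ψ ⟨g, le_sup_right (a := Q.toSubgroup) g.2⟩ : S) = α g := fun g =>
    congrArg Subtype.val (DFunLike.congr_fun hψα g)
  have hψR : ∀ x, (ψ x : S) ∈ R.toSubgroup := fun x => by
    obtain ⟨hxN, y, hy, hyx⟩ := hQP x.2
    -- `y ∈ R` and `ψ x` act alike on `P`, so they differ by an element of the centralizer of `P`,
    -- which lies in `P ≤ R`.
    have h1 : y⁻¹ * ψ x ∈ Subgroup.centralizer (P : Set S) := by
      rw [Subgroup.mem_centralizer_iff]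
      intro k hk
      obtain ⟨g, hg⟩ := α.surjective ⟨k, hk⟩
      have hgk : (α g : S) = k := congrArg Subtype.val hg
      let h : P := ⟨x * g * (x : S)⁻¹, (Subgroup.mem_normalizer_iff.1 hxN _).1 g.2⟩
      have h2 := hyx g h rfl
      have h3 : (⟨h, le_sup_right (a := Q.toSubgroup) h.2⟩ : (Q.toSubgroup ⊔ P : Subgroup S)) =
        x * ⟨g, le_sup_right (a := Q.toSubgroup) g.2⟩ * x⁻¹ := rfl
      rw [← hψα' h, h3, map_mul, map_mul, map_inv, Subgroup.coe_mul, Subgroup.coe_mul,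
        Subgroup.coe_inv, hψα', hgk] at h2
      calc k * (y⁻¹ * ψ x) = y⁻¹ * (y * k * y⁻¹) * ψ x := by group
        _ = y⁻¹ * (ψ x * k * (ψ x : S)⁻¹) * ψ x := by rw [h2]
        _ = y⁻¹ * ψ x * k := by group
    have h2 := hPR (hc P ⟨MulEquiv.refl P, F.id_mem P, F.id_mem P⟩ h1)
    have h3 := mul_mem hy h2
    rwa [mul_inv_cancel_left] at h3
  obtain ⟨χ, hχ, hχψ⟩ := exists_corestrict hψ (C := R.toSubgroup ⊔ P)
    fun x => (le_sup_left : R.toSubgroup ≤ _) (hψR x)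
  obtain ⟨k, hk⟩ := exists_map_eq (L := L) (X := Q.prod) (Y := R.prod) hχ
  have hmap : L.map (a.hom ≫ k) = L.map b.hom := by
    ext g
    rw [map_comp_apply, hk]
    refine (hχψ _).trans ?_
    obtain ⟨γ, -, hγ⟩ := Hom.exists_aut a
    have hgP : (g : S) ∈ P := (sup_le le_rfl le_rfl : P ⊔ P ≤ P) g.2
    have h1 : (Hom.toFun a g : S) = γ ⟨g, hgP⟩ := (hγ ⟨g, hgP⟩).symm
    refine Eq.trans ?_ (hab g _ h1)
    rw [← hψα']
    exact congrArg (fun x => (ψ x : S)) (Subtype.ext h1)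
  obtain ⟨z, -, hz⟩ := (map_eq_iff _ _).1 hmap
  -- The lift `k` matches `b` only up to `δ(z)` at the source; moved across `a`, this factor is
  -- absorbed into `h`.
  let h : Q.prod ⟶ R.prod := L.delta Q.prod (L.map a.hom z) ≫ k
  have hah : a.hom ≫ h = b.hom := by
    rw [hz, ← Category.assoc, ← Category.assoc, comp_delta]
  have hh : ∀ x, (L.map h x : S) ∈ R.toSubgroup := fun x => by
    rw [map_comp_apply, hk]
    exact Set.mem_of_eq_of_mem (hχψ _) (hψR _)
  have himage : homImage (homRestrict (L.map h) (le_sup_right : P ≤ Q.toSubgroup ⊔ P)) = P := by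
    obtain ⟨γ, -, hγ⟩ := Hom.exists_aut a
    obtain ⟨β, -, hβ⟩ := Hom.exists_aut b
    -- On `P`, `π(h)` is `β γ⁻¹`, where `γ` and `β` are the automorphisms induced by `a` and `b`.
    have h1 : ∀ g : P, (L.map h ⟨γ g, le_sup_right (a := Q.toSubgroup) (γ g).2⟩ : S) = β g :=
      fun g => by
        rw [hβ]
        have h2 := map_comp_apply a.hom h ⟨g, le_sup_right (a := P) g.2⟩
        rw [hah] at h2
        refine Eq.trans ?_ (congrArg Subtype.val h2).symm
        exact congrArg (fun x => (L.map h x : S)) (Subtype.ext (hγ g))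
    apply le_antisymm
    · rintro _ ⟨_, ⟨x, rfl⟩, rfl⟩
      obtain ⟨g, rfl⟩ := γ.surjective x
      exact Set.mem_of_eq_of_mem (h1 g) (β g).2
    · intro y hy
      obtain ⟨g, hg⟩ := β.surjective ⟨y, hy⟩
      exact ⟨_, ⟨γ g, rfl⟩, (h1 g).trans (congrArg Subtype.val hg)⟩
  obtain ⟨θ, hθ, hθh⟩ := exists_corestrict (C := R.toSubgroup)
    (F.comp_mem (F.inclusion_mem (le_sup_left : Q.toSubgroup ≤ Q.toSubgroup ⊔ P)) (map_mem h))
    fun x => hh _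
  have hres : homRestrict (L.map h) (le_sup_left : Q.toSubgroup ≤ Q.toSubgroup ⊔ P) =
      (Subgroup.inclusion le_sup_left).comp θ := by
    ext x
    exact (hθh x).symm
  exact ⟨⟨h, ⟨θ, ⟨hθ, L.map h, map_mem h, hres, himage⟩, hres⟩, himage⟩,
    NormalizerObj.Hom.ext hah⟩

theorem exists_inclusion (h : Q.toSubgroup ≤ R.toSubgroup) :
    ∃ i : Q ⟶ R, ∀ x, (Hom.toFun i x : S) = x := by
  have hle : Q.toSubgroup ⊔ P ≤ R.toSubgroup ⊔ P := sup_le_sup_right h P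
  obtain ⟨k, hk⟩ := exists_map_eq (L := L) (X := Q.prod) (Y := R.prod) (F.inclusion_mem hle)
  have himage : homImage (homRestrict (L.map k) (le_sup_right : P ≤ Q.toSubgroup ⊔ P)) = P := by
    rw [hk]
    apply le_antisymm
    · rintro _ ⟨_, ⟨x, rfl⟩, rfl⟩
      exact x.2
    · intro y hy
      exact ⟨_, ⟨⟨y, hy⟩, rfl⟩, rfl⟩
  have hres : homRestrict (L.map k) (le_sup_left : Q.toSubgroup ≤ Q.toSubgroup ⊔ P) =
      (Subgroup.inclusion le_sup_left).comp (Subgroup.inclusion h) := by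
    rw [hk]
    rfl
  exact ⟨⟨k, ⟨_, ⟨F.inclusion_mem h, L.map k, map_mem k, hres, himage⟩, hres⟩, himage⟩,
    fun x => congrArg Subtype.val (DFunLike.congr_fun hk x)⟩

/-- An isomorphism would make `π(a)` surjective onto `R P`, but its image is `P`. -/
theorem not_isIso_of_not_le (a : L.normalizerBase hc ⟶ R) (hR : ¬ R.toSubgroup ≤ P) :
    ¬ IsIso ((L.toLinking hc).map a) := by
  intro hiso
  refine hR fun x hx => ?_
  have hiso' : IsIso a.hom := hiso
  have h1 := map_comp_apply (inv a.hom) a.hom ⟨x, le_sup_left (b := P) hx⟩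
  rw [IsIso.inv_hom_id, L.map_id] at h1
  obtain ⟨γ, -, hγ⟩ := Hom.exists_aut a
  have h2 : ((L.map (inv a.hom) ⟨x, le_sup_left (b := P) hx⟩ :
      (L.normalizerBase hc).prod.toSubgroup) : S) ∈ P :=
    (sup_le le_rfl le_rfl : P ⊔ P ≤ P) (Subtype.property _)
  have h3 := (γ ⟨_, h2⟩).2
  rw [hγ] at h3
  exact Set.mem_of_eq_of_mem (congrArg Subtype.val h1) h3

end NormalizerObj

end FusionSystem.CentricLinkingSystem

/-! ### The zigzag of functors on the non-isomorphisms under `P` -/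

namespace FusionSystem.CentricLinkingSystem

variable {S : Type u} [Group S] {F : FusionSystem S} {L : F.CentricLinkingSystem}
  {P : Subgroup S} {hc : F.IsCentric P}

/-- The subgroup `Q P̃`, as an object of `N_L(P)`. -/
def NormalizerObj.joinTilde (Q : L.NormalizerObj hc) : L.NormalizerObj hc :=
  ⟨Q.toSubgroup ⊔ F.tilde P, sup_le Q.le_normalizer (F.tilde_le_normalizer P),
    (hc.of_le ((F.le_tilde P).trans le_sup_right)).isNormalizerCentric⟩

/-- A lift to `N_L(P)` of the inclusion of `Q` in `Q P̃`. -/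
noncomputable def NormalizerObj.toJoinTilde (Q : L.NormalizerObj hc) : Q ⟶ Q.joinTilde :=
  (NormalizerObj.exists_inclusion (Q := Q) (R := Q.joinTilde) le_sup_left).choose

theorem NormalizerObj.toJoinTilde_apply (Q : L.NormalizerObj hc)
    (x : (Q.toSubgroup ⊔ P : Subgroup S)) : (Hom.toFun Q.toJoinTilde x : S) = x :=
  (NormalizerObj.exists_inclusion (Q := Q) (R := Q.joinTilde) le_sup_left).choose_spec x

theorem NormalizerObj.le_joinTilde (Q : L.NormalizerObj hc) : P ≤ Q.joinTilde.toSubgroup :=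
  (F.le_tilde P).trans le_sup_right

variable (L hc) in
/-- A lift to `N_L(P)` of the inclusion of `P` in `P̃`. -/
noncomputable def baseToTilde : L.normalizerBase hc ⟶ L.normalizerTilde hc :=
  (NormalizerObj.exists_inclusion (Q := L.normalizerBase hc) (R := L.normalizerTilde hc)
    (F.le_tilde P)).choose

theorem baseToTilde_apply (x : (P ⊔ P : Subgroup S)) :
    (NormalizerObj.Hom.toFun (L.baseToTilde hc) x : S) = x :=
  (NormalizerObj.exists_inclusion (Q := L.normalizerBase hc) (R := L.normalizerTilde hc)
    (F.le_tilde P)).choose_spec x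

namespace NormalizerObj

variable {Q R : L.NormalizerObj hc} {p : ℕ}

theorem toFun_comp_toJoinTilde (a : L.normalizerBase hc ⟶ Q) (x : (P ⊔ P : Subgroup S)) :
    (Hom.toFun (a ≫ Q.toJoinTilde) x : S) = Hom.toFun a x :=
  (congrArg Subtype.val (Hom.toFun_comp a Q.toJoinTilde x)).trans (Q.toJoinTilde_apply _)

theorem exists_baseToTilde_comp_eq (hF : F.IsSaturated p) (hn : F.IsFullyNormalized p P)
    (a : L.normalizerBase hc ⟶ Q) :
    ∃ f : L.normalizerTilde hc ⟶ Q.joinTilde, L.baseToTilde hc ≫ f = a ≫ Q.toJoinTilde := by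
  obtain ⟨α, hα, hαX⟩ := Hom.exists_aut (a ≫ Q.toJoinTilde)
  refine exists_comp_eq hF hn _ _ Q.le_joinTilde hα (fun g g' hg => ?_)
    (tilde_le_relExtensionGroup hα le_sup_right)
  have h1 : (g' : S) = g := hg.symm.trans (baseToTilde_apply g)
  exact (hαX g').trans (congrArg (fun x => (Hom.toFun (a ≫ Q.toJoinTilde) x : S))
    (Subtype.ext h1))

/-- With `α` the restriction of `π(k)` to `P`, the required conjugations are induced by `π(k)(x) ∈
R` for `x ∈ Q` and by elements of `P̃` for `x ∈ P̃`. -/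
theorem exists_joinTilde_comp_eq (hF : F.IsSaturated p) (hn : F.IsFullyNormalized p P)
    {a : L.normalizerBase hc ⟶ Q} {b : L.normalizerBase hc ⟶ R} {k : Q ⟶ R} (hk : a ≫ k = b) :
    ∃ f : Q.joinTilde ⟶ R.joinTilde, (a ≫ Q.toJoinTilde) ≫ f = b ≫ R.toJoinTilde := by
  obtain ⟨α, hα, hαk⟩ := Hom.exists_aut k
  refine exists_comp_eq hF hn _ _ R.le_joinTilde hα (fun g g' hg => ?_)
    (sup_le (fun x hx => ?_) (tilde_le_relExtensionGroup hα le_sup_right))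
  · have h1 : (Hom.toFun a g : S) = g' := (toFun_comp_toJoinTilde a g).symm.trans hg
    have h2 : (Hom.toFun b g : S) = Hom.toFun k (Hom.toFun a g) := by
      rw [← hk]
      exact congrArg Subtype.val (Hom.toFun_comp a k g)
    refine (hαk g').trans (Eq.trans ?_ ((toFun_comp_toJoinTilde b g).trans h2).symm)
    exact congrArg (fun x => (Hom.toFun k x : S)) (Subtype.ext h1.symm)
  · let x' : (Q.toSubgroup ⊔ P : Subgroup S) := ⟨x, le_sup_left (b := P) hx⟩
    refine ⟨Q.le_normalizer hx, Hom.toFun k x',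
      le_sup_left (b := F.tilde P) (Hom.toFun_mem k x' hx), fun g g' hg => ?_⟩
    have h1 : (⟨g', le_sup_right (a := Q.toSubgroup) g'.2⟩ : (Q.toSubgroup ⊔ P : Subgroup S)) =
        x' * ⟨g, le_sup_right (a := Q.toSubgroup) g.2⟩ * x'⁻¹ := Subtype.ext hg.symm
    rw [hαk, hαk, h1, map_mul, map_mul, map_inv]
    rfl

end NormalizerObj

namespace NonIsoUnder

/-- Thinness reduces functors and natural transformations on this category to the mere existence of
morphisms. -/
instance : Quiver.IsThin (L.NonIsoUnder hc) := fun X _ => ⟨fun f g =>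
  ObjectProperty.hom_ext _ (Under.UnderMorphism.ext (NormalizerObj.eq_of_comp_eq X.obj.hom
    ((Under.w f.hom).trans (Under.w g.hom).symm)))⟩

theorem nonempty_hom_of_exists {X Y : L.NonIsoUnder hc}
    (h : ∃ f : X.obj.right ⟶ Y.obj.right, X.obj.hom ≫ f = Y.obj.hom) : Nonempty (X ⟶ Y) :=
  ⟨ObjectProperty.homMk (Under.homMk h.choose h.choose_spec)⟩

variable (h : P < F.tilde P)

/-- The object `P → P̃`. -/
noncomputable def base : L.NonIsoUnder hc :=
  ⟨Under.mk (L.baseToTilde hc), NormalizerObj.not_isIso_of_not_le _ h.not_ge⟩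

/-- The object `P → Q → Q P̃` attached to `P → Q`. -/
noncomputable def join (X : L.NonIsoUnder hc) : L.NonIsoUnder hc :=
  ⟨Under.mk (X.obj.hom ≫ X.obj.right.toJoinTilde), NormalizerObj.not_isIso_of_not_le _
    fun h' => h.not_ge (le_sup_right.trans h')⟩

theorem nonempty_hom_join (X : L.NonIsoUnder hc) : Nonempty (X ⟶ join h X) :=
  nonempty_hom_of_exists ⟨X.obj.right.toJoinTilde, rfl⟩

theorem nonempty_base_hom_join {p : ℕ} (hF : F.IsSaturated p) (hn : F.IsFullyNormalized p P)
    (X : L.NonIsoUnder hc) : Nonempty (base h ⟶ join h X) :=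
  nonempty_hom_of_exists (NormalizerObj.exists_baseToTilde_comp_eq hF hn X.obj.hom)

theorem nonempty_join_hom_join {p : ℕ} (hF : F.IsSaturated p) (hn : F.IsFullyNormalized p P)
    {X Y : L.NonIsoUnder hc} (f : X ⟶ Y) : Nonempty (join h X ⟶ join h Y) :=
  nonempty_hom_of_exists (NormalizerObj.exists_joinTilde_comp_eq hF hn (Under.w f.hom))

/-- The functor that sends `P → Q` to `P → Q P̃`. -/
noncomputable def joinFunctor {p : ℕ} (hF : F.IsSaturated p) (hn : F.IsFullyNormalized p P) :
    L.NonIsoUnder hc ⥤ L.NonIsoUnder hc where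
  obj := join h
  map f := (nonempty_join_hom_join h hF hn f).some
  map_id _ := Subsingleton.elim _ _
  map_comp _ _ := Subsingleton.elim _ _

theorem contractibleSpace {p : ℕ} (hF : F.IsSaturated p) (hn : F.IsFullyNormalized p P)
    (h : P < F.tilde P) : ContractibleSpace (nerveRealization (L.NonIsoUnder hc)) :=
  contractibleSpace_nerveRealization (joinFunctor h hF hn)
    { app := fun X => (nonempty_hom_join h X).some
      naturality := fun _ _ _ => Subsingleton.elim _ _ } (base h)
    { app := fun X => (nonempty_base_hom_join h hF hn X).some
      naturality := fun _ _ _ => Subsingleton.elim _ _ }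

end NonIsoUnder

end FusionSystem.CentricLinkingSystem

theorem contractibleSpace_nerveRealization_of_hasInitial {C : Type u} [Category.{v} C]
    [Limits.HasInitial C] : ContractibleSpace (nerveRealization C) :=
  contractibleSpace_nerveRealization (𝟭 C) (𝟙 _) (⊥_ C)
    { app := fun X => Limits.initial.to X
      naturality := fun _ _ _ => Limits.initialIsInitial.hom_ext _ _ }

theorem proposition4p1 {p : ℕ} [Fact p.Prime] {S : Type u} [Group S] (hS : IsDiscretePToral p S)
    (F : FusionSystem S) (hF : F.IsSaturated p) (L : FusionSystem.CentricLinkingSystem.{v} F)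
    (P : Subgroup S) (hn : F.IsFullyNormalized p P) (hc : F.IsCentric P)
    (hr : ¬ F.IsRadical p P) :
    IsGreatest {Q : Subgroup S | Q ≤ Subgroup.normalizer (P : Set S) ∧
        ∃ h : P ≤ Q, ∀ α ∈ F.aut P, ∃ ψ ∈ F.Hom Q ⊤,
          homRestrict ψ h = (Subgroup.inclusion le_top).comp α.toMonoidHom} (F.tilde P) ∧
      P < F.tilde P ∧
      Nonempty (ContinuousMap.HomotopyEquiv (nerveRealization (L.NonIsoUnder hc))
        (nerveRealization (Under (L.normalizerTilde hc)))) ∧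
      Limits.HasInitial (Under (L.normalizerTilde hc)) ∧
      ContractibleSpace (nerveRealization (L.NonIsoUnder hc)) ∧
      ContractibleSpace (nerveRealization (Under (L.normalizerTilde hc))) := by
  have hlt := hF.lt_tilde hn hr
  have hinit : Limits.HasInitial (Under (L.normalizerTilde hc)) :=
    Under.mkIdInitial.hasInitial
  have h1 : ContractibleSpace (nerveRealization (L.NonIsoUnder hc)) :=
    FusionSystem.CentricLinkingSystem.NonIsoUnder.contractibleSpace hF hn hlt
  have h2 : ContractibleSpace (nerveRealization (Under (L.normalizerTilde hc))) :=
    contractibleSpace_nerveRealization_of_hasInitial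
  exact ⟨hF.isGreatest_tilde hn, hlt, ContractibleSpace.hequiv _ _, hinit, h1, h2⟩
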